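/- Let $l>0$, let $p\ge 1$ and $n\ge 1$ be integers, let $D=\mathrm{diag}\{d_1,\dots,d_p\}$ with $d_1\ge d_2\ge\dots\ge d_p>0$, let $\beta$ be a complex $n\times n$ matrix and let $\Theta_1,\Theta_2$ be complex $n\times p$ matrices. Put $$k(x)=\Theta_2^*e^{ix\beta^*}\Theta_1\quad (x>0),\qquad k(-x)=k(x)^*,$$ and let $S$ be the operator with $D$-difference kernel in $L^2_p(0,l)=L^2((0,l);\mathbb C^p)$ given by $$(Sf)_i(x)=f_i(x)+\sum_{j=1}^p\int_0^l k_{ij}(d_ix-d_jt)f_j(t)\,dt .$$ Let $a=d_1l$ and let $E:L^2_p(0,l)\to L^2_p(0,a)$ be the embedding $(Ef)_j(z)=f_j(z/d_j)$ for $0<z<d_jl$, $(Ef)_j(z)=0$ for $d_jl<z<a$; $E^{-1}$ denotes its inverse, defined on the image of $E$. Let $\widetilde S=I+\int_0^a\widetilde k(y,z)\,\cdot\,dz$ in $L^2_p(0,a)$, where $\widetilde k_{ij}(y,z)=d_j^{-1}k_{ij}(y-z)$ if $0<z<d_jl$ and $0<y<d_il$, and $\widetilde k_{ij}(y,z)=0$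 if $z>d_jl$ or $y>d_il$. Let $\widetilde d_1>\widetilde d_2>\dots>\widetilde d_k>0$ be the distinct values among $d_1,\dots,d_p$, and put $\widetilde d_{k+1}=0$. For $2\le j\le k+1$ let $P_j$ be the diagonal $p\times p$ matrix whose $i$-th diagonal entry is $1$ if $d_i>\widetilde d_j$ and $0$ otherwise (so $P_{k+1}=I_p$). Let $$\mathcal A=i\begin{bmatrix}\beta^*&0\\0&\beta\end{bmatrix},\qquad \mathcal A_j^\times=\mathcal A+\begin{bmatrix}-\Theta_1\\ \Theta_2\end{bmatrix}D^{-1}P_j\begin{bmatrix}\Theta_2^*&\Theta_1^*\end{bmatrix},\qquad \widetilde J=\begin{bmatrix}0&-I_n\\I_n&0\end{bmatrix}.$$ Define the continuous $2n\times 2n$ matrix function $U$ on $[0,a]$ by $U(0)=I_{2n}$ and, successively for $j=k+1,k,\dots,2$, $$U(y)=e^{-y\mathcal A}\,e^{(y-\widetilde d_jl)\mathcal A_j^\times}\,e^{\widetilde d_jl\mathcal A}\,U(\widetilde d_jl)\qquad(\widetilde d_jl\le y\le\widetilde d_{j-1}l),$$ and for $\widetilde d_jl<y<\widetilde d_{j-1}l$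 put $$B(y)=e^{-y\mathcal A}\begin{bmatrix}-\Theta_1\\ \Theta_2\end{bmatrix}D^{-1}P_j,\qquad C(y)=P_j\begin{bmatrix}\Theta_2^*&\Theta_1^*\end{bmatrix}e^{y\mathcal A}.$$ Let $U_{21}(a)$, $U_{22}(a)$ be the lower $n\times n$ blocks of $U(a)$ and suppose that $\det U_{22}(a)\ne 0$. Put $$P^\times=\begin{bmatrix}0&0\\U_{22}(a)^{-1}U_{21}(a)&I_n\end{bmatrix},\qquad \widetilde T=I+\int_0^a\widetilde T(y,z)\,\cdot\,dz,$$ $$\widetilde T(y,z)=\begin{cases}C(y)U(y)(I_{2n}-P^\times)U(z)^{-1}B(z),&y>z,\\-C(y)U(y)P^\times U(z)^{-1}B(z),&y<z.\end{cases}$$ Then $S$ is self-adjoint, $S$ and $\widetilde S$ are boundedly invertible, the kernel $\widetilde T(y,z)$ is measurable and bounded, $\widetilde S^{-1}=\widetilde T$, the operator $\widetilde T$ maps the image of $E$ into itself, and $$S^{-1}=E^{-1}\widetilde T E .$$ Moreover $U$ is $\widetilde J$-unitary: $U(y)^*\widetilde JU(y)=\widetilde J$ for all $0\le y\le a$. 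-/

import Mathlib

open MeasureTheory
open scoped Matrix ENNReal

noncomputable section

namespace DDiff

/-! ### The spaces `L²_p(0,b)` and operators `I + ∫₀ᵇ K(x,t) · dt` -/

/-- Lebesgue measure on the interval `(0,b)`. -/
abbrev vol (b : ℝ) : Measure ℝ := volume.restrict (Set.Ioo 0 b)

/-- The space `L²_p(0,b)` of square integrable `ℂᵖ`-valued functions on `(0,b)`. -/
abbrev L2 (p : ℕ) (b : ℝ) : Type := Lp (EuclideanSpace ℂ (Fin p)) 2 (vol b)

variable {p n : ℕ}

/-- A `p × p` matrix kernel which is measurable, and bounded on `(0,b) × (0,b)`. -/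
def IsBoundedKernel (b : ℝ) (K : ℝ → ℝ → Matrix (Fin p) (Fin p) ℂ) : Prop :=
  (∀ i j, Measurable fun q : ℝ × ℝ => K q.1 q.2 i j) ∧
    ∃ M : ℝ, ∀ x ∈ Set.Ioo 0 b, ∀ t ∈ Set.Ioo 0 b, ∀ i j, ‖K x t i j‖ ≤ M

/-- The function `x ↦ ∫₀ᵇ K(x,t) f(t) dt`. -/
def integralFun (b : ℝ) (K : ℝ → ℝ → Matrix (Fin p) (Fin p) ℂ) (f : L2 p b) (x : ℝ) :
    EuclideanSpace ℂ (Fin p) :=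
  WithLp.toLp 2 fun i => ∑ j, ∫ t in Set.Ioo 0 b, K x t i j * f t j

theorem memLp_coord {b : ℝ} (f : L2 p b) (j : Fin p) : MemLp (fun t => f t j) 2 (vol b) :=
  (Lp.memLp f).eval_piLp j

theorem integrable_coord {b : ℝ} (f : L2 p b) (j : Fin p) :
    Integrable (fun t => f t j) (vol b) :=
  (memLp_coord f j).integrable (by norm_num)

theorem measurable_coord {b : ℝ} (f : L2 p b) (j : Fin p) : Measurable fun t => f t j := by
  have h := (Lp.stronglyMeasurable f).measurable
  fun_prop

theorem integrable_kernel_mul {b : ℝ} {K : ℝ → ℝ → Matrix (Fin p) (Fin p) ℂ}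
    (hK : IsBoundedKernel b K) (f : L2 p b) {x : ℝ} (hx : x ∈ Set.Ioo 0 b) (i j : Fin p) :
    Integrable (fun t => K x t i j * f t j) (vol b) := by
  obtain ⟨M, hM⟩ := hK.2
  refine (integrable_coord f j).bdd_mul (c := M) ?_ ?_
  · exact ((hK.1 i j).comp measurable_prodMk_left).aestronglyMeasurable
  · filter_upwards [ae_restrict_mem measurableSet_Ioo] with t ht using hM x hx t ht i j

theorem norm_euclidean_le_sum (v : EuclideanSpace ℂ (Fin p)) : ‖v‖ ≤ ∑ i, ‖v i‖ := by
  rw [EuclideanSpace.norm_eq]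
  refine Real.sqrt_le_iff.2 ⟨Finset.sum_nonneg fun i _ => norm_nonneg _, ?_⟩
  exact Finset.sum_sq_le_sq_sum_of_nonneg fun i _ => norm_nonneg _

theorem integral_norm_coord_le {b : ℝ} (f : L2 p b) (j : Fin p) :
    ∫ t, ‖f t j‖ ∂(vol b) ≤ (vol b Set.univ ^ (1 / 2 : ℝ)).toReal * ‖f‖ := by
  have h1 : ∫ t, ‖f t j‖ ∂(vol b) = (eLpNorm (fun t => f t j) 1 (vol b)).toReal := by
    rw [integral_norm_eq_lintegral_enorm (integrable_coord f j).1, eLpNorm_one_eq_lintegral_enorm]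
  have h2 := eLpNorm_le_eLpNorm_mul_rpow_measure_univ (p := 1) (q := 2) (by norm_num)
    (memLp_coord f j).1
  have h3 : eLpNorm (fun t => f t j) 2 (vol b) ≤ eLpNorm f 2 (vol b) :=
    eLpNorm_mono fun t => PiLp.norm_apply_le (f t) j
  rw [h1, Lp.norm_def, mul_comm, ← ENNReal.toReal_mul]
  have e : (1 / ENNReal.toReal 1 - 1 / ENNReal.toReal 2 : ℝ) = 1 / 2 := by norm_num
  rw [e] at h2
  refine ENNReal.toReal_mono ?_ (h2.trans (by gcongr))
  refine ENNReal.mul_ne_top (Lp.memLp f).2.ne ?_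
  exact ENNReal.rpow_ne_top_of_nonneg (by norm_num) (measure_ne_top _ _)

theorem norm_integralFun_le {b : ℝ} {K : ℝ → ℝ → Matrix (Fin p) (Fin p) ℂ}
    (hK : IsBoundedKernel b K) : ∃ C : ℝ, 0 ≤ C ∧ ∀ (f : L2 p b), ∀ x ∈ Set.Ioo 0 b,
      ‖integralFun b K f x‖ ≤ C * ‖f‖ := by
  obtain ⟨M, hM⟩ := hK.2
  refine ⟨∑ _i : Fin p, ∑ _j : Fin p, |M| * (vol b Set.univ ^ (1 / 2 : ℝ)).toReal,
    by positivity, fun f x hx => ?_⟩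
  refine (norm_euclidean_le_sum _).trans ?_
  rw [Finset.sum_mul]
  refine Finset.sum_le_sum fun i _ => ?_
  rw [Finset.sum_mul]
  have hi : ‖integralFun b K f x i‖ ≤ ∑ j, ‖∫ t in Set.Ioo 0 b, K x t i j * f t j‖ :=
    norm_sum_le (E := ℂ) Finset.univ fun j => ∫ t in Set.Ioo 0 b, K x t i j * f t j
  refine hi.trans (Finset.sum_le_sum fun j _ => ?_)
  refine (norm_integral_le_integral_norm _).trans ?_
  have : ∫ t in Set.Ioo 0 b, ‖K x t i j * f t j‖ ≤ ∫ t in Set.Ioo 0 b, |M| * ‖f t j‖ := by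
    refine setIntegral_mono_on (integrable_kernel_mul hK f hx i j).norm
      ((integrable_coord f j).norm.const_mul _) measurableSet_Ioo fun t ht => ?_
    rw [norm_mul]
    exact mul_le_mul_of_nonneg_right ((hM x hx t ht i j).trans (le_abs_self _)) (norm_nonneg _)
  refine this.trans ?_
  rw [integral_const_mul, mul_assoc]
  exact mul_le_mul_of_nonneg_left (integral_norm_coord_le f j) (abs_nonneg _)

theorem memLp_integralFun {b : ℝ} {K : ℝ → ℝ → Matrix (Fin p) (Fin p) ℂ}
    (hK : IsBoundedKernel b K) (f : L2 p b) : MemLp (integralFun b K f) 2 (vol b) := by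
  obtain ⟨C, -, hC⟩ := norm_integralFun_le hK
  refine MemLp.of_bound ?_ (C * ‖f‖) ?_
  · refine Measurable.aestronglyMeasurable ?_
    refine (PiLp.continuous_toLp 2 _).measurable.comp (measurable_pi_lambda _ fun i => ?_)
    refine Finset.measurable_sum _ fun j _ => ?_
    have h : StronglyMeasurable fun q : ℝ × ℝ => K q.1 q.2 i j * f q.2 j :=
      ((hK.1 i j).mul ((measurable_coord f j).comp measurable_snd)).stronglyMeasurable
    exact (StronglyMeasurable.integral_prod_right' (ν := vol b) h).measurable
  · filter_upwards [ae_restrict_mem measurableSet_Ioo] with x hx using hC f x hx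

/-- The bounded operator `f ↦ f + ∫₀ᵇ K(·,t) f(t) dt` in `L²_p(0,b)`. -/
def idPlus (b : ℝ) (K : ℝ → ℝ → Matrix (Fin p) (Fin p) ℂ) (hK : IsBoundedKernel b K) :
    L2 p b →L[ℂ] L2 p b :=
  ContinuousLinearMap.id ℂ (L2 p b) + LinearMap.mkContinuousOfExistsBound
    { toFun := fun f => (memLp_integralFun hK f).toLp (integralFun b K f)
      map_add' := fun f g => by
        rw [← MemLp.toLp_add]
        refine (MemLp.toLp_eq_toLp_iff _ _).2 ?_
        filter_upwards [ae_restrict_mem measurableSet_Ioo] with x hx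
        ext i
        simp only [integralFun, Pi.add_apply, PiLp.add_apply, ← Finset.sum_add_distrib]
        refine Finset.sum_congr rfl fun j _ => ?_
        rw [← integral_add (integrable_kernel_mul hK f hx i j)
          (integrable_kernel_mul hK g hx i j)]
        refine integral_congr_ae ?_
        filter_upwards [Lp.coeFn_add f g] with t ht
        rw [ht, Pi.add_apply, PiLp.add_apply, mul_add]
      map_smul' := fun c f => by
        rw [RingHom.id_apply, ← MemLp.toLp_const_smul]
        refine (MemLp.toLp_eq_toLp_iff _ _).2 (Filter.Eventually.of_forall fun x => ?_)
        ext i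
        simp only [integralFun, Pi.smul_apply, PiLp.smul_apply, smul_eq_mul, Finset.mul_sum]
        refine Finset.sum_congr rfl fun j _ => ?_
        rw [← integral_const_mul]
        refine integral_congr_ae ?_
        filter_upwards [Lp.coeFn_smul c f] with t ht
        rw [ht, Pi.smul_apply, PiLp.smul_apply, smul_eq_mul]
        ring }
    (by
      obtain ⟨C, hC0, hC⟩ := norm_integralFun_le hK
      refine ⟨(volume.restrict (Set.Ioo 0 b)).real Set.univ ^ (2 : ℝ≥0∞).toReal⁻¹ * C,
        fun f => ?_⟩
      rw [mul_assoc]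
      refine Lp.norm_le_of_ae_bound (by positivity) ?_
      filter_upwards [ae_restrict_mem measurableSet_Ioo,
        (memLp_integralFun hK f).coeFn_toLp] with x hx hx'
      simpa only [LinearMap.coe_mk, AddHom.coe_mk, hx'] using hC f x hx)

/-! ### The operator `S` with `D`-difference kernel -/

/-- The matrix function `k(x) = Θ₂^* e^{i x β^*} Θ₁` for `x > 0`, `k(-x) = k(x)^*`. -/
def k (β : Matrix (Fin n) (Fin n) ℂ) (Θ₁ Θ₂ : Matrix (Fin n) (Fin p) ℂ) (x : ℝ) :
    Matrix (Fin p) (Fin p) ℂ :=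
  if 0 < x then Θ₂ᴴ * NormedSpace.exp ((Complex.I * (x : ℂ)) • βᴴ) * Θ₁
  else (Θ₂ᴴ * NormedSpace.exp ((Complex.I * ((-x : ℝ) : ℂ)) • βᴴ) * Θ₁)ᴴ

/-- The kernel `k(x,t) = {k_{ij}(d_i x - d_j t)}`. -/
def kernelS (d : Fin p → ℝ) (β : Matrix (Fin n) (Fin n) ℂ) (Θ₁ Θ₂ : Matrix (Fin n) (Fin p) ℂ)
    (x t : ℝ) : Matrix (Fin p) (Fin p) ℂ :=
  Matrix.of fun i j => k β Θ₁ Θ₂ (d i * x - d j * t) i j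

/-- The kernel `k̃(y,z)`, with entries `d_j⁻¹ k_{ij}(y-z)` if `z < d_j l` and `y < d_i l`, and zero
otherwise. -/
def kernelSt (l : ℝ) (d : Fin p → ℝ) (β : Matrix (Fin n) (Fin n) ℂ)
    (Θ₁ Θ₂ : Matrix (Fin n) (Fin p) ℂ) (y z : ℝ) : Matrix (Fin p) (Fin p) ℂ :=
  Matrix.of fun i j =>
    if z < d j * l ∧ y < d i * l then (1 / d j : ℂ) * k β Θ₁ Θ₂ (y - z) i j else 0

theorem continuous_exp_matrix {m : Type*} [Fintype m] [DecidableEq m] :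
    Continuous (NormedSpace.exp : Matrix m m ℂ → Matrix m m ℂ) := by
  let _ : NormedRing (Matrix m m ℂ) := Matrix.linftyOpNormedRing
  let _ : NormedAlgebra ℂ (Matrix m m ℂ) := Matrix.linftyOpNormedAlgebra
  let _ : NormedAlgebra ℚ (Matrix m m ℂ) := NormedAlgebra.restrictScalars ℚ ℂ _
  exact NormedSpace.exp_continuous

theorem continuous_kpos (β : Matrix (Fin n) (Fin n) ℂ) (Θ₁ Θ₂ : Matrix (Fin n) (Fin p) ℂ) :
    Continuous fun x : ℝ => Θ₂ᴴ * NormedSpace.exp ((Complex.I * (x : ℂ)) • βᴴ) * Θ₁ := by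
  have h : Continuous fun x : ℝ => NormedSpace.exp ((Complex.I * (x : ℂ)) • βᴴ) :=
    continuous_exp_matrix.comp (by fun_prop)
  exact (continuous_const.matrix_mul h).matrix_mul continuous_const

theorem measurable_k (β : Matrix (Fin n) (Fin n) ℂ) (Θ₁ Θ₂ : Matrix (Fin n) (Fin p) ℂ)
    (i j : Fin p) : Measurable fun x => k β Θ₁ Θ₂ x i j := by
  have h1 := continuous_kpos β Θ₁ Θ₂
  have h2 : Continuous fun x : ℝ =>
      (Θ₂ᴴ * NormedSpace.exp ((Complex.I * ((-x : ℝ) : ℂ)) • βᴴ) * Θ₁)ᴴ :=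
    (h1.comp continuous_neg).matrix_conjTranspose
  have e : (fun x => k β Θ₁ Θ₂ x i j) = fun x : ℝ =>
      if 0 < x then (Θ₂ᴴ * NormedSpace.exp ((Complex.I * (x : ℂ)) • βᴴ) * Θ₁) i j
      else ((Θ₂ᴴ * NormedSpace.exp ((Complex.I * ((-x : ℝ) : ℂ)) • βᴴ) * Θ₁)ᴴ) i j := by
    funext x
    unfold k
    split_ifs <;> rfl
  rw [e]
  exact Measurable.ite measurableSet_Ioi (h1.matrix_elem i j).measurable
    (h2.matrix_elem i j).measurable

theorem bounded_k (β : Matrix (Fin n) (Fin n) ℂ) (Θ₁ Θ₂ : Matrix (Fin n) (Fin p) ℂ) (R : ℝ) :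
    ∃ M : ℝ, 0 ≤ M ∧ ∀ x : ℝ, |x| ≤ R → ∀ i j, ‖k β Θ₁ Θ₂ x i j‖ ≤ M := by
  have h : ∀ i j, ∃ M : ℝ, ∀ x ∈ Set.Icc (-R) R,
      ‖(Θ₂ᴴ * NormedSpace.exp ((Complex.I * (x : ℂ)) • βᴴ) * Θ₁) i j‖ ≤ M := fun i j =>
    isCompact_Icc.exists_bound_of_continuousOn
      ((continuous_kpos β Θ₁ Θ₂).matrix_elem i j).continuousOn
  choose M hM using h
  have hle : ∀ i j, M i j ≤ ∑ i, ∑ j, |M i j| := fun i j =>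
    (le_abs_self _).trans <|
      (Finset.single_le_sum (f := fun j => |M i j|) (fun _ _ => abs_nonneg _)
        (Finset.mem_univ j)).trans
      (Finset.single_le_sum (f := fun i => ∑ j, |M i j|)
        (fun _ _ => Finset.sum_nonneg fun _ _ => abs_nonneg _) (Finset.mem_univ i))
  refine ⟨∑ i, ∑ j, |M i j|, by positivity, fun x hx i j => ?_⟩
  unfold k
  split_ifs with h0
  · exact (hM i j x (abs_le.1 hx)).trans (hle i j)
  · rw [Matrix.conjTranspose_apply, norm_star]
    exact (hM j i (-x) (abs_le.1 (by rwa [abs_neg]))).trans (hle j i)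

theorem isBoundedKernel_kernelS (l : ℝ) (d : Fin p → ℝ) (β : Matrix (Fin n) (Fin n) ℂ)
    (Θ₁ Θ₂ : Matrix (Fin n) (Fin p) ℂ) : IsBoundedKernel l (kernelS d β Θ₁ Θ₂) := by
  refine ⟨fun i j => ?_, ?_⟩
  · exact (measurable_k β Θ₁ Θ₂ i j).comp (by fun_prop)
  · obtain ⟨M, -, hM⟩ := bounded_k β Θ₁ Θ₂ ((∑ i, |d i|) * |l| + (∑ i, |d i|) * |l|)
    have hs : ∀ i, ∀ x ∈ Set.Ioo 0 l, |d i * x| ≤ (∑ i, |d i|) * |l| := fun i x hx => by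
      rw [abs_mul]
      have h1 : |x| ≤ |l| := abs_le_abs_of_nonneg hx.1.le hx.2.le
      have h2 : |d i| ≤ ∑ i, |d i| :=
        Finset.single_le_sum (f := fun i => |d i|) (fun _ _ => abs_nonneg _) (Finset.mem_univ i)
      gcongr
    refine ⟨M, fun x hx t ht i j => hM _ ?_ i j⟩
    exact (abs_sub _ _).trans (add_le_add (hs i x hx) (hs j t ht))

theorem isBoundedKernel_kernelSt (l : ℝ) (d : Fin p → ℝ) (β : Matrix (Fin n) (Fin n) ℂ)
    (Θ₁ Θ₂ : Matrix (Fin n) (Fin p) ℂ) (a : ℝ) :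
    IsBoundedKernel a (kernelSt l d β Θ₁ Θ₂) := by
  refine ⟨fun i j => ?_, ?_⟩
  · refine Measurable.ite ?_ ?_ measurable_const
    · exact (measurableSet_lt measurable_snd measurable_const).inter
        (measurableSet_lt measurable_fst measurable_const)
    · exact measurable_const.mul ((measurable_k β Θ₁ Θ₂ i j).comp (by fun_prop))
  · obtain ⟨M, hM0, hM⟩ := bounded_k β Θ₁ Θ₂ |a|
    refine ⟨(∑ j, ‖(1 / d j : ℂ)‖) * M, fun y hy z hz i j => ?_⟩
    have h1 : ‖(1 / d j : ℂ)‖ ≤ ∑ j, ‖(1 / d j : ℂ)‖ :=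
      Finset.single_le_sum (f := fun j => ‖(1 / d j : ℂ)‖) (fun _ _ => norm_nonneg _)
        (Finset.mem_univ j)
    have h2 : ‖k β Θ₁ Θ₂ (y - z) i j‖ ≤ M := by
      refine hM _ ?_ i j
      have ha : |a| = a := abs_of_pos (hy.1.trans hy.2)
      rw [ha, abs_le]
      constructor <;> linarith [hy.1, hy.2, hz.1, hz.2]
    simp only [kernelSt, Matrix.of_apply]
    split_ifs
    · rw [norm_mul]
      gcongr
    · rw [norm_zero]
      positivity

/-- The operator `S = I + ∫₀ˡ k(x,t) · dt` in `L²_p(0,l)`. -/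
def S (l : ℝ) (d : Fin p → ℝ) (β : Matrix (Fin n) (Fin n) ℂ)
    (Θ₁ Θ₂ : Matrix (Fin n) (Fin p) ℂ) : L2 p l →L[ℂ] L2 p l :=
  idPlus l (kernelS d β Θ₁ Θ₂) (isBoundedKernel_kernelS l d β Θ₁ Θ₂)

/-- The operator `S̃ = I + ∫₀ᵃ k̃(y,z) · dz` in `L²_p(0,a)`, where `a = d₁ l`. -/
def St [NeZero p] (l : ℝ) (d : Fin p → ℝ) (β : Matrix (Fin n) (Fin n) ℂ)
    (Θ₁ Θ₂ : Matrix (Fin n) (Fin p) ℂ) : L2 p (d 0 * l) →L[ℂ] L2 p (d 0 * l) :=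
  idPlus (d 0 * l) (kernelSt l d β Θ₁ Θ₂) (isBoundedKernel_kernelSt l d β Θ₁ Θ₂ (d 0 * l))

/-! ### The embedding `E` -/

/-- `(Ef)_j(z) = f_j(z/d_j)` for `z < d_j l`, and zero for larger `z`. -/
def dilationFun (l : ℝ) (d : Fin p → ℝ) (f : L2 p l) (z : ℝ) : EuclideanSpace ℂ (Fin p) :=
  WithLp.toLp 2 fun j => if z < d j * l then f (z / d j) j else 0

theorem map_div_vol {l c : ℝ} (hc : 0 < c) :
    Measure.map (fun z : ℝ => z / c) (vol (c * l)) = ENNReal.ofReal c • vol l := by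
  have hpre : (fun z : ℝ => z / c) ⁻¹' Set.Ioo 0 l = Set.Ioo 0 (c * l) := by
    ext z
    simp only [Set.mem_preimage, Set.mem_Ioo, div_lt_iff₀ hc, mul_comm c l]
    constructor
    · rintro ⟨h1, h2⟩
      exact ⟨by simpa [div_mul_cancel₀ z hc.ne'] using mul_pos h1 hc, h2⟩
    · rintro ⟨h1, h2⟩
      exact ⟨div_pos h1 hc, h2⟩
  have hm : Measurable fun z : ℝ => z / c := by fun_prop
  rw [vol, ← hpre, ← Measure.restrict_map hm measurableSet_Ioo, vol, ← Measure.restrict_smul]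
  congr 1
  have := Real.map_volume_mul_right (a := c⁻¹) (inv_ne_zero hc.ne')
  rw [inv_inv, abs_of_pos hc] at this
  simpa only [div_eq_mul_inv] using this

theorem quasi_div {l c : ℝ} (hc : 0 < c) :
    Measure.QuasiMeasurePreserving (fun z : ℝ => z / c) (vol (c * l)) (vol l) := by
  refine ⟨by fun_prop, ?_⟩
  rw [map_div_vol hc]
  exact Measure.smul_absolutelyContinuous

theorem restrict_Iio_vol_le (a m : ℝ) : (vol a).restrict (Set.Iio m) ≤ vol m := by
  rw [Measure.restrict_restrict measurableSet_Iio]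
  refine Measure.restrict_mono (fun x hx => ?_) le_rfl
  exact Set.mem_Ioo.2 ⟨hx.2.1, hx.1⟩

theorem eLpNorm_dilation {l c : ℝ} (hc : 0 < c) {g : ℝ → ℂ} (hg : MemLp g 2 (vol l)) (a : ℝ) :
    MemLp (fun z => if z < c * l then g (z / c) else 0) 2 (vol a) ∧
    eLpNorm (fun z => if z < c * l then g (z / c) else 0) 2 (vol a) ≤
      ENNReal.ofReal c ^ (1 / 2 : ℝ) * eLpNorm g 2 (vol l) := by
  have hind : (fun z => if z < c * l then g (z / c) else 0) =
      (Set.Iio (c * l)).indicator fun z => g (z / c) := by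
    funext z
    simp [Set.indicator_apply]
  have hg' : MemLp g 2 (ENNReal.ofReal c • vol l) := hg.smul_measure ENNReal.ofReal_ne_top
  have hm : AEMeasurable (fun z : ℝ => z / c) (vol (c * l)) := by fun_prop
  rw [← map_div_vol hc] at hg'
  have hcomp : MemLp (fun z => g (z / c)) 2 (vol (c * l)) :=
    (memLp_map_measure_iff hg'.1 hm).1 hg'
  have hnorm : eLpNorm (fun z => g (z / c)) 2 (vol (c * l)) =
      ENNReal.ofReal c ^ (1 / 2 : ℝ) * eLpNorm g 2 (vol l) := by
    have := eLpNorm_map_measure (p := 2) hg'.1 hm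
    rw [map_div_vol hc, eLpNorm_smul_measure_of_ne_top (by norm_num)] at this
    rw [show (fun z => g (z / c)) = g ∘ fun z : ℝ => z / c from rfl, ← this]
    simp
  rw [hind]
  refine ⟨(memLp_indicator_iff_restrict measurableSet_Iio).2
    (hcomp.mono_measure (restrict_Iio_vol_le a _)), ?_⟩
  rw [eLpNorm_indicator_eq_eLpNorm_restrict measurableSet_Iio, ← hnorm]
  exact eLpNorm_mono_measure _ (restrict_Iio_vol_le a _)

theorem memLp_dilationFun {l : ℝ} {d : Fin p → ℝ} (hd : ∀ i, 0 < d i) (f : L2 p l) (a : ℝ) :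
    MemLp (dilationFun l d f) 2 (vol a) :=
  MemLp.of_eval_piLp fun j => (eLpNorm_dilation (hd j) (memLp_coord f j) a).1

theorem eLpNorm_dilationFun_le {l : ℝ} {d : Fin p → ℝ} (hd : ∀ i, 0 < d i) (f : L2 p l)
    (a : ℝ) : eLpNorm (dilationFun l d f) 2 (vol a) ≤
      (∑ j, ENNReal.ofReal (d j) ^ (1 / 2 : ℝ)) * eLpNorm f 2 (vol l) := by
  have h1 : eLpNorm (dilationFun l d f) 2 (vol a) ≤
      eLpNorm (∑ j, fun z => ‖dilationFun l d f z j‖) 2 (vol a) := by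
    refine eLpNorm_mono_real fun z => ?_
    rw [Finset.sum_apply]
    exact norm_euclidean_le_sum _
  refine h1.trans ((eLpNorm_sum_le (fun j _ =>
    ((memLp_dilationFun hd f a).eval_piLp j).1.norm) (by norm_num)).trans ?_)
  rw [Finset.sum_mul]
  refine Finset.sum_le_sum fun j _ => ?_
  rw [eLpNorm_norm]
  refine (eLpNorm_dilation (hd j) (memLp_coord f j) a).2.trans ?_
  gcongr
  exact eLpNorm_mono fun t => PiLp.norm_apply_le (f t) j

theorem dilationFun_congr {l : ℝ} {d : Fin p → ℝ} (hd : ∀ i, 0 < d i) (a : ℝ)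
    {P : Fin p → ℝ → Prop} (hP : ∀ᵐ x ∂(vol l), ∀ j, P j x) :
    ∀ᵐ z ∂(vol a), ∀ j, z < d j * l → P j (z / d j) := by
  rw [ae_all_iff]
  intro j
  have h1 : ∀ᵐ z ∂(vol (d j * l)), P j (z / d j) :=
    (quasi_div (hd j)).ae (hP.mono fun x hx => hx j)
  have h2 := ae_mono (restrict_Iio_vol_le a (d j * l)) h1
  exact (ae_restrict_iff' measurableSet_Iio).1 h2

/-- The operator `E` from `L²_p(0,l)` into `L²_p(0,a)`, where `a = d₁ l`. -/
def E [NeZero p] (l : ℝ) (d : Fin p → ℝ) (hd : ∀ i, 0 < d i) :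
    L2 p l →L[ℂ] L2 p (d 0 * l) :=
  LinearMap.mkContinuousOfExistsBound
    { toFun := fun f => (memLp_dilationFun hd f (d 0 * l)).toLp (dilationFun l d f)
      map_add' := fun f g => by
        rw [← MemLp.toLp_add]
        refine (MemLp.toLp_eq_toLp_iff _ _).2 ?_
        have h : ∀ᵐ x ∂(vol l), ∀ j, (f + g) x j = f x j + g x j := by
          filter_upwards [Lp.coeFn_add f g] with x hx j
          rw [hx, Pi.add_apply, PiLp.add_apply]
        filter_upwards [dilationFun_congr hd (d 0 * l) h] with z hz
        ext j
        simp only [dilationFun, Pi.add_apply, PiLp.add_apply]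
        split_ifs with hj
        · exact hz j hj
        · simp
      map_smul' := fun c f => by
        rw [RingHom.id_apply, ← MemLp.toLp_const_smul]
        refine (MemLp.toLp_eq_toLp_iff _ _).2 ?_
        have h : ∀ᵐ x ∂(vol l), ∀ j, (c • f) x j = c * f x j := by
          filter_upwards [Lp.coeFn_smul c f] with x hx j
          rw [hx, Pi.smul_apply, PiLp.smul_apply, smul_eq_mul]
        filter_upwards [dilationFun_congr hd (d 0 * l) h] with z hz
        ext j
        simp only [dilationFun, Pi.smul_apply, PiLp.smul_apply, smul_eq_mul]
        split_ifs with hj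
        · exact hz j hj
        · simp }
    (by
      refine ⟨(∑ j, ENNReal.ofReal (d j) ^ (1 / 2 : ℝ)).toReal, fun f => ?_⟩
      simp only [LinearMap.coe_mk, AddHom.coe_mk]
      rw [Lp.norm_toLp, Lp.norm_def, ← ENNReal.toReal_mul]
      refine ENNReal.toReal_mono (ENNReal.mul_ne_top ?_ (Lp.memLp f).2.ne)
        (eLpNorm_dilationFun_le hd f _)
      exact ENNReal.sum_ne_top.2 fun j _ =>
        ENNReal.rpow_ne_top_of_nonneg (by norm_num) ENNReal.ofReal_ne_top)

theorem E_injective [NeZero p] {l : ℝ} (hl : 0 < l) {d : Fin p → ℝ} (hd : ∀ i, 0 < d i)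
    (hanti : Antitone d) : Function.Injective (E l d hd) := by
  rw [injective_iff_map_eq_zero]
  intro f hf
  have h0 : dilationFun l d f =ᵐ[vol (d 0 * l)] 0 := by
    have h1 : (memLp_dilationFun hd f (d 0 * l)).toLp (dilationFun l d f) = 0 := hf
    filter_upwards [(memLp_dilationFun hd f (d 0 * l)).coeFn_toLp,
      Lp.coeFn_zero (EuclideanSpace ℂ (Fin p)) 2 (vol (d 0 * l))] with z hz hz'
    rw [← hz, h1, hz']
  refine (Lp.eq_zero_iff_ae_eq_zero).2 ?_
  have key : ∀ j, ∀ᵐ x ∂(vol l), f x j = 0 := by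
    intro j
    have hle : vol (d j * l) ≤ vol (d 0 * l) := Measure.restrict_mono
      (Set.Ioo_subset_Ioo_right (mul_le_mul_of_nonneg_right (hanti (Fin.zero_le j)) hl.le)) le_rfl
    have h2 : ∀ᵐ z ∂(vol (d j * l)), f (z / d j) j = 0 := by
      filter_upwards [ae_mono hle h0, ae_restrict_mem measurableSet_Ioo] with z hz hz'
      have := congrArg (fun v : EuclideanSpace ℂ (Fin p) => v j) hz
      simpa [dilationFun, hz'.2] using this
    have h3 : ∀ᵐ x ∂(Measure.map (fun z : ℝ => z / d j) (vol (d j * l))), f x j = 0 := by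
      refine (ae_map_iff (by fun_prop) ?_).2 h2
      exact measurable_coord f j (measurableSet_singleton 0)
    rw [map_div_vol (hd j)] at h3
    exact (Measure.absolutelyContinuous_smul (ENNReal.ofReal_pos.2 (hd j)).ne').ae_le h3
  filter_upwards [ae_all_iff.2 key] with x hx
  ext j
  exact hx j

/-- The inverse `E⁻¹`, defined on the image of `E`. -/
def Einv [NeZero p] {l : ℝ} (hl : 0 < l) {d : Fin p → ℝ} (hd : ∀ i, 0 < d i)
    (hanti : Antitone d) : (E l d hd).toLinearMap.range ≃ₗ[ℂ] L2 p l :=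
  (LinearEquiv.ofInjective (E l d hd).toLinearMap (E_injective hl hd hanti)).symm

/-! ### The piecewise exponential matrix function `U` -/

/-- The number of distinct values among `d₁, …, d_p`. -/
def numVals (d : Fin p → ℝ) : ℕ := (Finset.univ.image d).card

/-- The distinct values `d̃₁ > d̃₂ > … > d̃_k` of `d` (`k = numVals d`), continued by
`d̃_{k+1} = 0`. The argument is the index, which starts with `1`. -/
def dt (d : Fin p → ℝ) (j : ℕ) : ℝ :=
  ((Finset.univ.image d).sort (fun x y => x ≥ y)).getD (j - 1) 0

/-- The projector `P_j`, `2 ≤ j ≤ k+1`, onto the coordinates which belong to the first `j-1` blocks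
of `D`, that is, with `d_i > d̃_j`; in particular `P_{k+1} = I`. -/
def P (d : Fin p → ℝ) (j : ℕ) : Matrix (Fin p) (Fin p) ℂ :=
  Matrix.diagonal fun i => if dt d j < d i then 1 else 0

/-- `D⁻¹`. -/
def Dinv (d : Fin p → ℝ) : Matrix (Fin p) (Fin p) ℂ :=
  Matrix.diagonal fun i => ((d i)⁻¹ : ℂ)

/-- The matrix `𝒜 = i diag(β^*, β)`. -/
def A (β : Matrix (Fin n) (Fin n) ℂ) : Matrix (Fin n ⊕ Fin n) (Fin n ⊕ Fin n) ℂ :=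
  Complex.I • Matrix.fromBlocks βᴴ 0 0 β

/-- The exponential `e^{y 𝒜}`. -/
def expA (β : Matrix (Fin n) (Fin n) ℂ) (y : ℝ) : Matrix (Fin n ⊕ Fin n) (Fin n ⊕ Fin n) ℂ :=
  NormedSpace.exp ((y : ℂ) • A β)

/-- The column of blocks `[-Θ₁; Θ₂]`. -/
def col (Θ₁ Θ₂ : Matrix (Fin n) (Fin p) ℂ) : Matrix (Fin n ⊕ Fin n) (Fin p) ℂ :=
  Matrix.fromRows (-Θ₁) Θ₂

/-- The row of blocks `[Θ₂^*, Θ₁^*]`. -/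
def row (Θ₁ Θ₂ : Matrix (Fin n) (Fin p) ℂ) : Matrix (Fin p) (Fin n ⊕ Fin n) ℂ :=
  Matrix.fromCols Θ₂ᴴ Θ₁ᴴ

/-- The matrix `𝒜_j^× = 𝒜 + Y_j`, `Y_j = [-Θ₁; Θ₂] D⁻¹ P_j [Θ₂^*, Θ₁^*]`. -/
def Ax (d : Fin p → ℝ) (β : Matrix (Fin n) (Fin n) ℂ) (Θ₁ Θ₂ : Matrix (Fin n) (Fin p) ℂ)
    (j : ℕ) : Matrix (Fin n ⊕ Fin n) (Fin n ⊕ Fin n) ℂ :=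
  A β + col Θ₁ Θ₂ * Dinv d * P d j * row Θ₁ Θ₂

/-- The factor `e^{-y𝒜} e^{(y - d̃_j l)𝒜_j^×} e^{d̃_j l 𝒜}`, which carries `U(d̃_j l)` into `U(y)` for
`d̃_j l ≤ y ≤ d̃_{j-1} l`. -/
def transfer (l : ℝ) (d : Fin p → ℝ) (β : Matrix (Fin n) (Fin n) ℂ)
    (Θ₁ Θ₂ : Matrix (Fin n) (Fin p) ℂ) (j : ℕ) (y : ℝ) :
    Matrix (Fin n ⊕ Fin n) (Fin n ⊕ Fin n) ℂ :=
  expA β (-y) * NormedSpace.exp (((y - dt d j * l : ℝ) : ℂ) • Ax d β Θ₁ Θ₂ j) *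
    expA β (dt d j * l)

/-- The values at the nodes: `Unode r = U(d̃_{k+1-r} l)`, `0 ≤ r ≤ k`, obtained successively from
`U(0) = I`. -/
def Unode (l : ℝ) (d : Fin p → ℝ) (β : Matrix (Fin n) (Fin n) ℂ)
    (Θ₁ Θ₂ : Matrix (Fin n) (Fin p) ℂ) : ℕ → Matrix (Fin n ⊕ Fin n) (Fin n ⊕ Fin n) ℂ
  | 0 => 1
  | r + 1 => transfer l d β Θ₁ Θ₂ (numVals d + 1 - r) (dt d (numVals d - r) * l) *
      Unode l d β Θ₁ Θ₂ r

/-- The number of nodes `d̃_k l, …, d̃₁ l` which do not exceed `y`. -/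
def nodesPassed (l : ℝ) (d : Fin p → ℝ) (y : ℝ) : ℕ :=
  ((Finset.univ.image d).filter fun δ => δ * l ≤ y).card

/-- The index `j` with `d̃_j l ≤ y < d̃_{j-1} l`, for `0 ≤ y < d̃₁ l` (it is `1` for
`y = d̃₁ l`). -/
def idx (l : ℝ) (d : Fin p → ℝ) (y : ℝ) : ℕ := numVals d + 1 - nodesPassed l d y

/-- The matrix function `U` on `[0,a]`, determined by `U(0) = I` and
`U(y) = e^{-y𝒜} e^{(y - d̃_j l)𝒜_j^×} e^{d̃_j l 𝒜} U(d̃_j l)` for `d̃_j l ≤ y ≤ d̃_{j-1} l`,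
`2 ≤ j ≤ k+1`. -/
def U (l : ℝ) (d : Fin p → ℝ) (β : Matrix (Fin n) (Fin n) ℂ)
    (Θ₁ Θ₂ : Matrix (Fin n) (Fin p) ℂ) (y : ℝ) : Matrix (Fin n ⊕ Fin n) (Fin n ⊕ Fin n) ℂ :=
  transfer l d β Θ₁ Θ₂ (idx l d y) y * Unode l d β Θ₁ Θ₂ (nodesPassed l d y)

/-! ### The semiseparable inverse -/

/-- `B(y) = e^{-y𝒜} [-Θ₁; Θ₂] D⁻¹ P_j` for `d̃_j l < y < d̃_{j-1} l`. -/
def B (l : ℝ) (d : Fin p → ℝ) (β : Matrix (Fin n) (Fin n) ℂ)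
    (Θ₁ Θ₂ : Matrix (Fin n) (Fin p) ℂ) (y : ℝ) : Matrix (Fin n ⊕ Fin n) (Fin p) ℂ :=
  expA β (-y) * col Θ₁ Θ₂ * Dinv d * P d (idx l d y)

/-- `C(y) = P_j [Θ₂^*, Θ₁^*] e^{y𝒜}` for `d̃_j l < y < d̃_{j-1} l`. -/
def C (l : ℝ) (d : Fin p → ℝ) (β : Matrix (Fin n) (Fin n) ℂ)
    (Θ₁ Θ₂ : Matrix (Fin n) (Fin p) ℂ) (y : ℝ) : Matrix (Fin p) (Fin n ⊕ Fin n) ℂ :=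
  P d (idx l d y) * row Θ₁ Θ₂ * expA β y

/-- `P^× = [[0, 0], [U₂₂(a)⁻¹ U₂₁(a), I]]`, given the matrix `U(a)`. -/
def Px (Ua : Matrix (Fin n ⊕ Fin n) (Fin n ⊕ Fin n) ℂ) :
    Matrix (Fin n ⊕ Fin n) (Fin n ⊕ Fin n) ℂ :=
  Matrix.fromBlocks 0 0 (Ua.toBlocks₂₂⁻¹ * Ua.toBlocks₂₁) 1

/-- The kernel `T̃(y,z)`: `C(y) U(y) (I - P^×) U(z)⁻¹ B(z)` for `y > z`, and
`-C(y) U(y) P^× U(z)⁻¹ B(z)` for `y < z`. -/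
def kernelT [NeZero p] (l : ℝ) (d : Fin p → ℝ) (β : Matrix (Fin n) (Fin n) ℂ)
    (Θ₁ Θ₂ : Matrix (Fin n) (Fin p) ℂ) (y z : ℝ) : Matrix (Fin p) (Fin p) ℂ :=
  if z < y then
    C l d β Θ₁ Θ₂ y * U l d β Θ₁ Θ₂ y * (1 - Px (U l d β Θ₁ Θ₂ (d 0 * l))) *
      (U l d β Θ₁ Θ₂ z)⁻¹ * B l d β Θ₁ Θ₂ z
  else
    -(C l d β Θ₁ Θ₂ y * U l d β Θ₁ Θ₂ y * Px (U l d β Θ₁ Θ₂ (d 0 * l)) *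
      (U l d β Θ₁ Θ₂ z)⁻¹ * B l d β Θ₁ Θ₂ z)

/-- The matrix `J̃ = [[0, -I], [I, 0]]`. -/
def Jt (n : ℕ) : Matrix (Fin n ⊕ Fin n) (Fin n ⊕ Fin n) ℂ :=
  Matrix.fromBlocks 0 (-1) 1 0

end DDiff

end

/-!
The kernel of `S̃` is semiseparable: the two diagonal blocks of `e^{x𝒜}` produce the values of `k`
on the two half lines, so that it equals `-C(y) (H(y - z) - P) B(z)`, where `H` is the Heaviside
function and `P = diag(0, I)` (`kernelSt_eq`). In the same notation the kernel of `T̃` is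
`C(y) U(y) (H(y - z) - P^×) U(z)⁻¹ B(z)` (`kernelT_eq`).

On each interval between two neighbouring nodes `d̃_j l`, the function `U` solves `U' = B C U`
(`hasDerivAt_U`), and it is continuous on `[0,a]` (`continuousOn_U`). Composing the kernels of `S̃`
and `T̃` therefore means integrating `(H(x - s) - P) U'(s) (H(s - t) - P^×)`, which the fundamental
theorem of calculus does explicitly (`hasIntegral_jump_mul_mul_jump`). The matrix `P^×` is made so
that the boundary terms at `a` cancel: `P U(a) (I - P^×) = 0` (`Plow_mul_mul_Px`). What remains is
`K + T + K ∘ T = 0`, and `S̃ T̃ = I` follows by Fubini (`idPlus_mul_idPlus`). The equation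
`(U⁻¹)' = -U⁻¹ B C` and the identity `P^× U(a)⁻¹ (I - P) = 0` give `T̃ S̃ = I` in the same way.

A change of variables shows `S̃ E = E S` (`St_E`), hence `T̃ E S = E`. As `E` is bounded below
(`exists_norm_le_norm_E`), so is `S`; being self-adjoint, as its kernel is Hermitian, `S` is
invertible. Then `T̃ E = E S⁻¹`, which contains both the invariance of the image of `E` and the
formula for `S⁻¹`.

The `J̃`-unitarity of `U` comes from `X^* J̃ + J̃ X = 0` for `X = 𝒜` and `X = 𝒜_j^×`, because `U` is
a product of exponentials of real multiples of such matrices. It also shows that `U` is invertible,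
with inverse `-J̃ U^* J̃`.
-/

namespace DDiff

variable {p n : ℕ}

/-! ### The nodes `d̃_j l` -/

theorem dt_succ_of_lt (d : Fin p → ℝ) {i : ℕ} (hi : i < numVals d) :
    dt d (i + 1) = ((Finset.univ.image d).sort (fun x y => x ≥ y))[i]'(by
      rwa [Finset.length_sort]) := by
  rw [dt, Nat.add_sub_cancel, List.getD_eq_getElem]

theorem dt_succ_of_le (d : Fin p → ℝ) {i : ℕ} (hi : numVals d ≤ i) : dt d (i + 1) = 0 := by
  rw [dt, Nat.add_sub_cancel, List.getD_eq_default]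
  rwa [Finset.length_sort]

theorem dt_succ_mem (d : Fin p → ℝ) {i : ℕ} (hi : i < numVals d) :
    dt d (i + 1) ∈ Finset.univ.image d := by
  rw [dt_succ_of_lt d hi, ← Finset.mem_sort (fun x y : ℝ => x ≥ y)]
  exact List.getElem_mem _

theorem exists_dt_succ_eq (d : Fin p → ℝ) (i : Fin p) :
    ∃ r < numVals d, dt d (r + 1) = d i := by
  have h : d i ∈ (Finset.univ.image d).sort (fun x y => x ≥ y) :=
    (Finset.mem_sort _).2 (Finset.mem_image_of_mem d (Finset.mem_univ i))
  obtain ⟨r, hr, e⟩ := List.getElem_of_mem h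
  have hr' : r < numVals d := by rwa [Finset.length_sort] at hr
  exact ⟨r, hr', by rw [dt_succ_of_lt d hr', e]⟩

theorem dt_succ_pos {d : Fin p → ℝ} (hd : ∀ i, 0 < d i) {i : ℕ} (hi : i < numVals d) :
    0 < dt d (i + 1) := by
  obtain ⟨j, -, hj⟩ := Finset.mem_image.1 (dt_succ_mem d hi)
  exact hj ▸ hd j

/-- The distinct values decrease strictly, down to and including the final value `0`. -/
theorem dt_succ_lt {d : Fin p → ℝ} (hd : ∀ i, 0 < d i) {i j : ℕ} (hij : i < j)
    (hi : i < numVals d) : dt d (j + 1) < dt d (i + 1) := by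
  rcases lt_or_ge j (numVals d) with hj | hj
  · rw [dt_succ_of_lt d hi, dt_succ_of_lt d hj]
    exact List.pairwise_iff_getElem.1
      (Finset.sortedGT_sort (Finset.univ.image d)).pairwise i j _ _ hij
  · rw [dt_succ_of_le d hj]
    exact dt_succ_pos hd hi

theorem dt_succ_le {d : Fin p → ℝ} (hd : ∀ i, 0 < d i) {i j : ℕ} (hij : i ≤ j) :
    dt d (j + 1) ≤ dt d (i + 1) := by
  rcases hij.eq_or_lt with rfl | hij
  · exact le_rfl
  · rcases lt_or_ge i (numVals d) with hi | hi
    · exact (dt_succ_lt hd hij hi).le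
    · rw [dt_succ_of_le d hi, dt_succ_of_le d (hi.trans hij.le)]

theorem nodesPassed_le (l : ℝ) (d : Fin p → ℝ) (y : ℝ) : nodesPassed l d y ≤ numVals d :=
  Finset.card_filter_le _ _

theorem nodesPassed_eq_card {d : Fin p → ℝ} (hd : ∀ i, 0 < d i) (l y : ℝ) :
    nodesPassed l d y =
      ((Finset.range (numVals d)).filter fun i => dt d (i + 1) * l ≤ y).card := by
  symm
  refine Finset.card_bij (fun i _ => dt d (i + 1)) ?_ ?_ ?_
  · intro i hi
    rw [Finset.mem_filter, Finset.mem_range] at hi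
    exact Finset.mem_filter.2 ⟨dt_succ_mem d hi.1, hi.2⟩
  · intro i hi j hj h
    rw [Finset.mem_filter, Finset.mem_range] at hi hj
    rcases lt_trichotomy i j with hij | hij | hij
    · exact absurd h (dt_succ_lt hd hij hi.1).ne'
    · exact hij
    · exact absurd h (dt_succ_lt hd hij hj.1).ne
  · intro δ hδ
    rw [Finset.mem_filter] at hδ
    obtain ⟨j, -, rfl⟩ := Finset.mem_image.1 hδ.1
    obtain ⟨r, hr, e⟩ := exists_dt_succ_eq d j
    exact ⟨r, Finset.mem_filter.2 ⟨Finset.mem_range.2 hr, by rw [e]; exact hδ.2⟩, e⟩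

/-- The nodes which do not exceed `y` are the last ones in the decreasing enumeration. -/
theorem dt_succ_mul_le_iff {l : ℝ} (hl : 0 < l) {d : Fin p → ℝ} (hd : ∀ i, 0 < d i) {i : ℕ}
    (hi : i < numVals d) (y : ℝ) :
    dt d (i + 1) * l ≤ y ↔ numVals d ≤ nodesPassed l d y + i := by
  rw [nodesPassed_eq_card hd l y]
  constructor
  · intro h
    have hsub : Finset.Ico i (numVals d) ⊆
        (Finset.range (numVals d)).filter fun i => dt d (i + 1) * l ≤ y := by
      intro j hj
      rw [Finset.mem_Ico] at hj
      refine Finset.mem_filter.2 ⟨Finset.mem_range.2 hj.2, le_trans ?_ h⟩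
      exact mul_le_mul_of_nonneg_right (dt_succ_le hd hj.1) hl.le
    have := Finset.card_le_card hsub
    rw [Nat.card_Ico] at this
    omega
  · intro h
    by_contra hc
    have hsub : ((Finset.range (numVals d)).filter fun i => dt d (i + 1) * l ≤ y) ⊆
        Finset.Ico (i + 1) (numVals d) := by
      intro j hj
      rw [Finset.mem_filter, Finset.mem_range] at hj
      rw [Finset.mem_Ico]
      refine ⟨?_, hj.1⟩
      by_contra hji
      refine hc (le_trans ?_ hj.2)
      exact mul_le_mul_of_nonneg_right (dt_succ_le hd (by omega)) hl.le
    have := Finset.card_le_card hsub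
    rw [Nat.card_Ico] at this
    omega

/-- The nodes in increasing order: `node 0 = 0`, `node r = d̃_{k+1-r} l`, `node k = d̃₁ l = a`. -/
noncomputable def node (l : ℝ) (d : Fin p → ℝ) (r : ℕ) : ℝ := dt d (numVals d - r + 1) * l

theorem node_eq (l : ℝ) (d : Fin p → ℝ) {r : ℕ} (hr : r ≤ numVals d) :
    node l d r = dt d (numVals d + 1 - r) * l := by
  rw [node, show numVals d - r + 1 = numVals d + 1 - r by omega]

theorem node_zero (l : ℝ) (d : Fin p → ℝ) : node l d 0 = 0 := by
  rw [node, dt_succ_of_le d (by omega), zero_mul]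

theorem numVals_pos [NeZero p] (d : Fin p → ℝ) : 0 < numVals d :=
  Finset.card_pos.2 ⟨d 0, Finset.mem_image_of_mem d (Finset.mem_univ 0)⟩

theorem node_numVals [NeZero p] (l : ℝ) {d : Fin p → ℝ} (hd : ∀ i, 0 < d i)
    (hanti : Antitone d) : node l d (numVals d) = d 0 * l := by
  rw [node, Nat.sub_self]
  congr 1
  apply le_antisymm
  · obtain ⟨j, -, hj⟩ := Finset.mem_image.1 (dt_succ_mem d (numVals_pos d))
    rw [← hj]
    exact hanti (Fin.zero_le j)
  · obtain ⟨r, -, e⟩ := exists_dt_succ_eq d 0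
    rw [← e]
    exact dt_succ_le hd (Nat.zero_le r)

theorem node_lt_node_succ {l : ℝ} (hl : 0 < l) {d : Fin p → ℝ} (hd : ∀ i, 0 < d i) {r : ℕ}
    (hr : r < numVals d) : node l d r < node l d (r + 1) :=
  mul_lt_mul_of_pos_right (dt_succ_lt hd (by omega) (by omega)) hl

theorem nodesPassed_eq_of_mem {l : ℝ} (hl : 0 < l) {d : Fin p → ℝ} (hd : ∀ i, 0 < d i) {r : ℕ}
    (hr : r < numVals d) {y : ℝ} (hy : y ∈ Set.Ico (node l d r) (node l d (r + 1))) :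
    nodesPassed l d y = r := by
  have h1 : ¬ numVals d ≤ nodesPassed l d y + (numVals d - (r + 1)) := fun h =>
    hy.2.not_ge ((dt_succ_mul_le_iff hl hd (by omega) y).2 h)
  rcases Nat.eq_zero_or_pos r with h0 | h0
  · omega
  · have := (dt_succ_mul_le_iff hl hd (i := numVals d - r) (by omega) y).1 hy.1
    omega

theorem nodesPassed_node {l : ℝ} (hl : 0 < l) {d : Fin p → ℝ} (hd : ∀ i, 0 < d i) {r : ℕ}
    (hr : r ≤ numVals d) : nodesPassed l d (node l d r) = r := by
  rcases hr.eq_or_lt with rfl | hr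
  · refine le_antisymm (nodesPassed_le _ _ _) ?_
    rcases Nat.eq_zero_or_pos (numVals d) with h0 | h0
    · omega
    have := (dt_succ_mul_le_iff hl hd (i := 0) h0 (node l d (numVals d))).1 (by
      rw [node, Nat.sub_self])
    omega
  · exact nodesPassed_eq_of_mem hl hd hr ⟨le_rfl, node_lt_node_succ hl hd hr⟩

theorem mem_Ico_node {l : ℝ} (hl : 0 < l) {d : Fin p → ℝ} (hd : ∀ i, 0 < d i) {y : ℝ}
    (hy0 : 0 ≤ y) (hy : y < node l d (numVals d)) :
    nodesPassed l d y < numVals d ∧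
      y ∈ Set.Ico (node l d (nodesPassed l d y)) (node l d (nodesPassed l d y + 1)) := by
  have hle := nodesPassed_le l d y
  have hlt : nodesPassed l d y < numVals d := by
    refine lt_of_le_of_ne hle fun h => ?_
    rcases Nat.eq_zero_or_pos (numVals d) with h0 | h0
    · rw [h0, node_zero] at hy
      exact hy.not_ge hy0
    · refine hy.not_ge ((dt_succ_mul_le_iff hl hd (i := _) ?_ y).2 ?_) <;> omega
  refine ⟨hlt, ?_, ?_⟩
  · rcases Nat.eq_zero_or_pos (nodesPassed l d y) with h0 | h0
    · rwa [h0, node_zero]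
    · exact (dt_succ_mul_le_iff hl hd (by omega) y).2 (by omega)
  · by_contra hc
    have := (dt_succ_mul_le_iff hl hd (by omega) y).1 (not_lt.1 hc)
    omega

/-- The projector active at `y` selects exactly the coordinates `i` with `y < d_i l`. -/
theorem dt_idx_lt_iff {l : ℝ} (hl : 0 < l) {d : Fin p → ℝ} (hd : ∀ i, 0 < d i) (y : ℝ)
    (i : Fin p) : dt d (idx l d y) < d i ↔ y < d i * l := by
  have hle := nodesPassed_le l d y
  obtain ⟨r, hr, e⟩ := exists_dt_succ_eq d i
  rw [idx, show numVals d + 1 - nodesPassed l d y = numVals d - nodesPassed l d y + 1 by omega,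
    ← e, ← not_le, ← not_le, not_iff_not, dt_succ_mul_le_iff hl hd hr y]
  constructor
  · intro h
    by_contra hc
    exact h.not_gt (dt_succ_lt hd (by omega) hr)
  · intro h
    exact dt_succ_le hd (by omega)

theorem P_idx {l : ℝ} (hl : 0 < l) {d : Fin p → ℝ} (hd : ∀ i, 0 < d i) (y : ℝ) :
    P d (idx l d y) = Matrix.diagonal fun i => if y < d i * l then 1 else 0 := by
  rw [P]
  congr 1
  ext i
  simp only [dt_idx_lt_iff hl hd]

/-! ### `J̃`-unitary matrices -/

theorem Jt_mul_Jt (n : ℕ) : Jt n * Jt n = -1 := by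
  rw [Jt, Matrix.fromBlocks_multiply, ← Matrix.fromBlocks_one, Matrix.fromBlocks_neg]
  simp

/-- The exponential of a `J̃`-skew-adjoint matrix is `J̃`-unitary. -/
theorem conjTranspose_exp_mul_Jt_mul_exp {X : Matrix (Fin n ⊕ Fin n) (Fin n ⊕ Fin n) ℂ}
    (h : Xᴴ * Jt n + Jt n * X = 0) :
    (NormedSpace.exp X)ᴴ * Jt n * NormedSpace.exp X = Jt n := by
  have he := (Matrix.exp_conjTranspose X).symm
  let _ : NormedRing (Matrix (Fin n ⊕ Fin n) (Fin n ⊕ Fin n) ℂ) := Matrix.linftyOpNormedRing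
  let _ : NormedAlgebra ℂ (Matrix (Fin n ⊕ Fin n) (Fin n ⊕ Fin n) ℂ) :=
    Matrix.linftyOpNormedAlgebra
  let _ : NormedAlgebra ℚ (Matrix (Fin n ⊕ Fin n) (Fin n ⊕ Fin n) ℂ) :=
    NormedAlgebra.restrictScalars ℚ ℂ _
  have hs : SemiconjBy (Jt n) X (-Xᴴ) := by
    rw [SemiconjBy, Matrix.neg_mul]
    exact eq_neg_of_add_eq_zero_right h
  have := hs.exp_neg_mul_mul_exp_eq_self
  rw [neg_neg] at this
  rw [he]
  exact this

theorem conjTranspose_exp_smul_mul_Jt_mul_exp {X : Matrix (Fin n ⊕ Fin n) (Fin n ⊕ Fin n) ℂ}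
    (h : Xᴴ * Jt n + Jt n * X = 0) (y : ℝ) :
    (NormedSpace.exp ((y : ℂ) • X))ᴴ * Jt n * NormedSpace.exp ((y : ℂ) • X) = Jt n := by
  apply conjTranspose_exp_mul_Jt_mul_exp
  rw [Matrix.conjTranspose_smul, Matrix.smul_mul, Matrix.mul_smul, Complex.star_def,
    Complex.conj_ofReal, ← smul_add, h, smul_zero]

theorem Jt_unitary_mul {X Y : Matrix (Fin n ⊕ Fin n) (Fin n ⊕ Fin n) ℂ}
    (hX : Xᴴ * Jt n * X = Jt n) (hY : Yᴴ * Jt n * Y = Jt n) :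
    (X * Y)ᴴ * Jt n * (X * Y) = Jt n := by
  rw [Matrix.conjTranspose_mul]
  calc Yᴴ * Xᴴ * Jt n * (X * Y) = Yᴴ * (Xᴴ * Jt n * X) * Y := by simp only [Matrix.mul_assoc]
    _ = Jt n := by rw [hX, hY]

theorem A_Jt (β : Matrix (Fin n) (Fin n) ℂ) : (A β)ᴴ * Jt n + Jt n * A β = 0 := by
  rw [A, Jt, Matrix.conjTranspose_smul, Matrix.fromBlocks_conjTranspose, Matrix.smul_mul,
    Matrix.mul_smul, Matrix.fromBlocks_multiply, Matrix.fromBlocks_multiply]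
  simp [Matrix.fromBlocks_smul]

theorem Jt_mul_col (Θ₁ Θ₂ : Matrix (Fin n) (Fin p) ℂ) :
    Jt n * col Θ₁ Θ₂ = -(row Θ₁ Θ₂)ᴴ := by
  rw [Jt, col, row, Matrix.conjTranspose_fromCols_eq_fromRows_conjTranspose,
    Matrix.fromBlocks_mul_fromRows]
  ext (i | i) j <;> simp

theorem Dinv_mul_P (d : Fin p → ℝ) (j : ℕ) :
    Dinv d * P d j = Matrix.diagonal fun i => if dt d j < d i then ((d i)⁻¹ : ℂ) else 0 := by
  rw [Dinv, P, Matrix.diagonal_mul_diagonal]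
  congr 1
  ext i
  simp

theorem Ax_Jt (d : Fin p → ℝ) (β : Matrix (Fin n) (Fin n) ℂ) (Θ₁ Θ₂ : Matrix (Fin n) (Fin p) ℂ)
    (j : ℕ) : (Ax d β Θ₁ Θ₂ j)ᴴ * Jt n + Jt n * Ax d β Θ₁ Θ₂ j = 0 := by
  have hJ : (Jt n)ᴴ = -Jt n := by
    rw [Jt, Matrix.fromBlocks_conjTranspose, Matrix.fromBlocks_neg]
    simp
  have hD : (Dinv d * P d j)ᴴ = Dinv d * P d j := by
    rw [Dinv_mul_P, Matrix.diagonal_conjTranspose]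
    congr 1
    ext i
    simp only [Pi.star_apply]
    split_ifs <;> simp
  have hc : (col Θ₁ Θ₂)ᴴ * Jt n = row Θ₁ Θ₂ := by
    have := congrArg Matrix.conjTranspose (Jt_mul_col Θ₁ Θ₂)
    rwa [Matrix.conjTranspose_mul, hJ, Matrix.conjTranspose_neg,
      Matrix.conjTranspose_conjTranspose, Matrix.mul_neg, neg_inj] at this
  have h1 : (col Θ₁ Θ₂ * Dinv d * P d j * row Θ₁ Θ₂)ᴴ * Jt n =
      (row Θ₁ Θ₂)ᴴ * (Dinv d * P d j) * row Θ₁ Θ₂ := by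
    rw [Matrix.mul_assoc (col Θ₁ Θ₂), Matrix.conjTranspose_mul, Matrix.conjTranspose_mul, hD,
      Matrix.mul_assoc, Matrix.mul_assoc, hc, ← Matrix.mul_assoc]
  have h2 : Jt n * (col Θ₁ Θ₂ * Dinv d * P d j * row Θ₁ Θ₂) =
      -((row Θ₁ Θ₂)ᴴ * (Dinv d * P d j) * row Θ₁ Θ₂) := by
    rw [Matrix.mul_assoc (col Θ₁ Θ₂), ← Matrix.mul_assoc, ← Matrix.mul_assoc, Jt_mul_col]
    simp only [Matrix.neg_mul]
  rw [Ax, Matrix.conjTranspose_add, Matrix.add_mul, Matrix.mul_add, h1, h2]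
  have := A_Jt β
  rw [add_add_add_comm, this, zero_add, add_neg_cancel]

theorem transfer_Jt (l : ℝ) (d : Fin p → ℝ) (β : Matrix (Fin n) (Fin n) ℂ)
    (Θ₁ Θ₂ : Matrix (Fin n) (Fin p) ℂ) (j : ℕ) (y : ℝ) :
    (transfer l d β Θ₁ Θ₂ j y)ᴴ * Jt n * transfer l d β Θ₁ Θ₂ j y = Jt n :=
  Jt_unitary_mul (Jt_unitary_mul (conjTranspose_exp_smul_mul_Jt_mul_exp (A_Jt β) _)
    (conjTranspose_exp_smul_mul_Jt_mul_exp (Ax_Jt d β Θ₁ Θ₂ j) _))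
    (conjTranspose_exp_smul_mul_Jt_mul_exp (A_Jt β) _)

theorem Unode_Jt (l : ℝ) (d : Fin p → ℝ) (β : Matrix (Fin n) (Fin n) ℂ)
    (Θ₁ Θ₂ : Matrix (Fin n) (Fin p) ℂ) (r : ℕ) :
    (Unode l d β Θ₁ Θ₂ r)ᴴ * Jt n * Unode l d β Θ₁ Θ₂ r = Jt n := by
  induction r with
  | zero => simp [Unode]
  | succ r ih => exact Jt_unitary_mul (transfer_Jt ..) ih

theorem U_Jt (l : ℝ) (d : Fin p → ℝ) (β : Matrix (Fin n) (Fin n) ℂ)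
    (Θ₁ Θ₂ : Matrix (Fin n) (Fin p) ℂ) (y : ℝ) :
    (U l d β Θ₁ Θ₂ y)ᴴ * Jt n * U l d β Θ₁ Θ₂ y = Jt n :=
  Jt_unitary_mul (transfer_Jt ..) (Unode_Jt ..)

theorem inv_eq_of_Jt_unitary {X : Matrix (Fin n ⊕ Fin n) (Fin n ⊕ Fin n) ℂ}
    (hX : Xᴴ * Jt n * X = Jt n) : X⁻¹ = -(Jt n * Xᴴ * Jt n) := by
  refine Matrix.inv_eq_left_inv ?_
  rw [Matrix.neg_mul, Matrix.mul_assoc, Matrix.mul_assoc, ← Matrix.mul_assoc Xᴴ, hX, Jt_mul_Jt,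
    neg_neg]

theorem isUnit_of_Jt_unitary {X : Matrix (Fin n ⊕ Fin n) (Fin n ⊕ Fin n) ℂ}
    (hX : Xᴴ * Jt n * X = Jt n) : IsUnit X := by
  refine IsUnit.of_mul_eq_one_right (-(Jt n * Xᴴ) * Jt n) ?_
  rw [Matrix.neg_mul, Matrix.neg_mul, Matrix.mul_assoc, Matrix.mul_assoc, ← Matrix.mul_assoc Xᴴ,
    hX, Jt_mul_Jt, neg_neg]

/-! ### The differential equation `U' = B C U` -/

/-- The coefficient `e^{-y𝒜} [-Θ₁; Θ₂] D⁻¹ P_j [Θ₂^*, Θ₁^*] e^{y𝒜}` of the differential equation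
on the `j`-th interval. -/
noncomputable def coeff (d : Fin p → ℝ) (β : Matrix (Fin n) (Fin n) ℂ)
    (Θ₁ Θ₂ : Matrix (Fin n) (Fin p) ℂ) (j : ℕ) (y : ℝ) : Matrix (Fin n ⊕ Fin n) (Fin n ⊕ Fin n) ℂ :=
  expA β (-y) * (col Θ₁ Θ₂ * Dinv d * P d j * row Θ₁ Θ₂) * expA β y

theorem B_mul_C (l : ℝ) (d : Fin p → ℝ) (β : Matrix (Fin n) (Fin n) ℂ)
    (Θ₁ Θ₂ : Matrix (Fin n) (Fin p) ℂ) (y : ℝ) :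
    B l d β Θ₁ Θ₂ y * C l d β Θ₁ Θ₂ y = coeff d β Θ₁ Θ₂ (idx l d y) y := by
  have hP : P d (idx l d y) * P d (idx l d y) = P d (idx l d y) := by
    rw [P, Matrix.diagonal_mul_diagonal]
    congr 1
    ext i
    simp
  rw [B, C, coeff]
  calc _ = expA β (-y) * col Θ₁ Θ₂ * Dinv d * (P d (idx l d y) * P d (idx l d y)) *
        row Θ₁ Θ₂ * expA β y := by simp only [Matrix.mul_assoc]
    _ = _ := by rw [hP]; simp only [Matrix.mul_assoc]

theorem expA_mul_expA_neg (β : Matrix (Fin n) (Fin n) ℂ) (y : ℝ) :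
    expA β y * expA β (-y) = 1 := by
  rw [expA, expA, ← Matrix.exp_add_of_commute]
  · simp
  · exact ((Commute.refl (A β)).smul_left _).smul_right _

theorem expA_neg_mul_expA (β : Matrix (Fin n) (Fin n) ℂ) (y : ℝ) :
    expA β (-y) * expA β y = 1 := by
  simpa using expA_mul_expA_neg β (-y)

theorem continuous_expA (β : Matrix (Fin n) (Fin n) ℂ) : Continuous (expA β) :=
  continuous_exp_matrix.comp (by fun_prop)

theorem continuous_transfer (l : ℝ) (d : Fin p → ℝ) (β : Matrix (Fin n) (Fin n) ℂ)
    (Θ₁ Θ₂ : Matrix (Fin n) (Fin p) ℂ) (j : ℕ) : Continuous (transfer l d β Θ₁ Θ₂ j) := by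
  have h1 := (continuous_expA β).comp continuous_neg
  have h2 : Continuous fun y : ℝ =>
      NormedSpace.exp (((y - dt d j * l : ℝ) : ℂ) • Ax d β Θ₁ Θ₂ j) :=
    continuous_exp_matrix.comp (by fun_prop)
  exact (h1.matrix_mul h2).matrix_mul continuous_const

section Deriv

attribute [local instance] Matrix.linftyOpNormedRing Matrix.linftyOpNormedAlgebra

theorem hasDerivAt_exp_smul_matrix {m : Type*} [Fintype m] [DecidableEq m] (X : Matrix m m ℂ)
    (y : ℝ) : HasDerivAt (fun y : ℝ => NormedSpace.exp ((y : ℂ) • X))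
      (X * NormedSpace.exp ((y : ℂ) • X)) y := by
  have e : ∀ y : ℝ, (y : ℂ) • X = y • X := fun y => by
    ext i j
    simp
  simp only [e]
  exact hasDerivAt_exp_smul_const' X y

theorem hasDerivAt_transfer (l : ℝ) (d : Fin p → ℝ) (β : Matrix (Fin n) (Fin n) ℂ)
    (Θ₁ Θ₂ : Matrix (Fin n) (Fin p) ℂ) (j : ℕ) (y : ℝ) :
    HasDerivAt (transfer l d β Θ₁ Θ₂ j)
      (coeff d β Θ₁ Θ₂ j y * transfer l d β Θ₁ Θ₂ j y) y := by
  have h1 : HasDerivAt (fun y : ℝ => expA β (-y)) (-(expA β (-y) * A β)) y := by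
    have := (hasDerivAt_exp_smul_matrix (A β) (-y)).scomp y (hasDerivAt_neg y)
    rw [neg_one_smul] at this
    have hc : A β * expA β (-y) = expA β (-y) * A β := by
      let _ : NormedAlgebra ℚ (Matrix (Fin n ⊕ Fin n) (Fin n ⊕ Fin n) ℂ) :=
        NormedAlgebra.restrictScalars ℚ ℂ _
      exact ((Commute.refl (A β)).smul_right _).exp_right
    rw [← hc]
    exact this
  have h2 := (hasDerivAt_exp_smul_matrix (Ax d β Θ₁ Θ₂ j) (y - dt d j * l)).scomp y
    ((hasDerivAt_id y).sub_const (dt d j * l))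
  rw [one_smul] at h2
  have h3 := (h1.mul h2).mul_const (expA β (dt d j * l))
  refine h3.congr_deriv ?_
  have e : coeff d β Θ₁ Θ₂ j y * transfer l d β Θ₁ Θ₂ j y =
      expA β (-y) * (Ax d β Θ₁ Θ₂ j - A β) *
        NormedSpace.exp (((y - dt d j * l : ℝ) : ℂ) • Ax d β Θ₁ Θ₂ j) * expA β (dt d j * l) := by
    rw [coeff, transfer, Ax, add_sub_cancel_left]
    calc _ = expA β (-y) * (col Θ₁ Θ₂ * Dinv d * P d j * row Θ₁ Θ₂) * (expA β y *
          expA β (-y)) * NormedSpace.exp (((y - dt d j * l : ℝ) : ℂ) • Ax d β Θ₁ Θ₂ j) *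
          expA β (dt d j * l) := by simp only [Matrix.mul_assoc, Ax]
      _ = _ := by rw [expA_mul_expA_neg, Matrix.mul_one, Ax]
  rw [e]
  simp only [Function.comp, id]
  noncomm_ring

/-- The factor carrying `U` across an interval starts from the identity at the left endpoint, so
that `U` does not jump at the nodes. -/
theorem transfer_self (l : ℝ) (d : Fin p → ℝ) (β : Matrix (Fin n) (Fin n) ℂ)
    (Θ₁ Θ₂ : Matrix (Fin n) (Fin p) ℂ) (j : ℕ) :
    transfer l d β Θ₁ Θ₂ j (dt d j * l) = 1 := by
  rw [transfer, sub_self]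
  simp [expA_neg_mul_expA]

theorem U_zero {l : ℝ} (hl : 0 < l) {d : Fin p → ℝ} (hd : ∀ i, 0 < d i)
    (β : Matrix (Fin n) (Fin n) ℂ) (Θ₁ Θ₂ : Matrix (Fin n) (Fin p) ℂ) :
    U l d β Θ₁ Θ₂ 0 = 1 := by
  have h0 : nodesPassed l d 0 = 0 := by
    rw [← node_zero l d]
    exact nodesPassed_node hl hd (Nat.zero_le _)
  have h1 := transfer_self l d β Θ₁ Θ₂ (numVals d + 1)
  rw [dt_succ_of_le d le_rfl, zero_mul] at h1
  rw [U, idx, h0, Unode, Matrix.mul_one, Nat.sub_zero, h1]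

/-- The formula which defines `U` on a half-open interval between two nodes holds at the right
endpoint as well. -/
theorem U_eq_on_Icc_node {l : ℝ} (hl : 0 < l) {d : Fin p → ℝ} (hd : ∀ i, 0 < d i)
    (β : Matrix (Fin n) (Fin n) ℂ) (Θ₁ Θ₂ : Matrix (Fin n) (Fin p) ℂ) {r : ℕ}
    (hr : r < numVals d) {y : ℝ} (hy : y ∈ Set.Icc (node l d r) (node l d (r + 1))) :
    U l d β Θ₁ Θ₂ y = transfer l d β Θ₁ Θ₂ (numVals d + 1 - r) y * Unode l d β Θ₁ Θ₂ r := by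
  rcases hy.2.lt_or_eq with h | rfl
  · have hN := nodesPassed_eq_of_mem hl hd hr ⟨hy.1, h⟩
    rw [U, idx, hN]
  · rw [U, idx, nodesPassed_node hl hd hr, Unode]
    have h1 := transfer_self l d β Θ₁ Θ₂ (numVals d + 1 - (r + 1))
    rw [← node_eq l d hr] at h1
    rw [h1, Matrix.one_mul]
    rw [node_eq l d hr, show numVals d + 1 - (r + 1) = numVals d - r by omega]

theorem continuousOn_U {l : ℝ} (hl : 0 < l) {d : Fin p → ℝ} (hd : ∀ i, 0 < d i)
    (β : Matrix (Fin n) (Fin n) ℂ) (Θ₁ Θ₂ : Matrix (Fin n) (Fin p) ℂ) :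
    ContinuousOn (U l d β Θ₁ Θ₂) (Set.Icc 0 (node l d (numVals d))) := by
  have key : ∀ r ≤ numVals d, 0 ≤ node l d r ∧
      ContinuousOn (U l d β Θ₁ Θ₂) (Set.Icc 0 (node l d r)) := by
    intro r
    induction r with
    | zero =>
      intro _
      rw [node_zero, Set.Icc_self]
      exact ⟨le_rfl, continuousOn_singleton _ _⟩
    | succ r ih =>
      intro hr
      obtain ⟨h0, hc⟩ := ih (by omega)
      have hlt := node_lt_node_succ hl hd (r := r) (by omega)
      refine ⟨h0.trans hlt.le, ?_⟩
      rw [← Set.Icc_union_Icc_eq_Icc h0 hlt.le]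
      refine hc.union_of_isClosed ?_ isClosed_Icc isClosed_Icc
      refine ContinuousOn.congr ?_ fun y hy => U_eq_on_Icc_node hl hd β Θ₁ Θ₂ (by omega) hy
      exact ((continuous_transfer l d β Θ₁ Θ₂ _).matrix_mul continuous_const).continuousOn
  exact (key _ le_rfl).2

/-- Away from the nodes, `U' = B C U`. -/
theorem hasDerivAt_U {l : ℝ} (hl : 0 < l) {d : Fin p → ℝ} (hd : ∀ i, 0 < d i)
    (β : Matrix (Fin n) (Fin n) ℂ) (Θ₁ Θ₂ : Matrix (Fin n) (Fin p) ℂ) {y : ℝ}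
    (hy : y ∈ Set.Ioo 0 (node l d (numVals d)) \ Set.range (node l d)) :
    HasDerivAt (U l d β Θ₁ Θ₂)
      (B l d β Θ₁ Θ₂ y * C l d β Θ₁ Θ₂ y * U l d β Θ₁ Θ₂ y) y := by
  obtain ⟨hr, hmem⟩ := mem_Ico_node hl hd hy.1.1.le hy.1.2
  have hmem' : y ∈ Set.Ioo (node l d (nodesPassed l d y)) (node l d (nodesPassed l d y + 1)) :=
    ⟨lt_of_le_of_ne hmem.1 fun h => hy.2 ⟨_, h⟩, hmem.2⟩
  have hev : U l d β Θ₁ Θ₂ =ᶠ[nhds y] fun y' =>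
      transfer l d β Θ₁ Θ₂ (idx l d y) y' * Unode l d β Θ₁ Θ₂ (nodesPassed l d y) := by
    filter_upwards [isOpen_Ioo.mem_nhds hmem'] with y' hy'
    exact U_eq_on_Icc_node hl hd β Θ₁ Θ₂ hr ⟨hy'.1.le, hy'.2.le⟩
  refine HasDerivAt.congr_of_eventuallyEq ?_ hev
  refine ((hasDerivAt_transfer l d β Θ₁ Θ₂ (idx l d y) y).mul_const _).congr_deriv ?_
  rw [B_mul_C, U, Matrix.mul_assoc]

theorem continuousOn_U_inv {l : ℝ} (hl : 0 < l) {d : Fin p → ℝ} (hd : ∀ i, 0 < d i)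
    (β : Matrix (Fin n) (Fin n) ℂ) (Θ₁ Θ₂ : Matrix (Fin n) (Fin p) ℂ) :
    ContinuousOn (fun y => (U l d β Θ₁ Θ₂ y)⁻¹) (Set.Icc 0 (node l d (numVals d))) := by
  simp only [inv_eq_of_Jt_unitary (U_Jt l d β Θ₁ Θ₂ _)]
  have h := (Continuous.matrix_conjTranspose
    (continuous_id : Continuous fun X : Matrix (Fin n ⊕ Fin n) (Fin n ⊕ Fin n) ℂ => X))
    |>.comp_continuousOn (continuousOn_U hl hd β Θ₁ Θ₂)
  exact ((continuousOn_const.mul h).mul continuousOn_const).neg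

theorem hasDerivAt_U_inv {l : ℝ} (hl : 0 < l) {d : Fin p → ℝ} (hd : ∀ i, 0 < d i)
    (β : Matrix (Fin n) (Fin n) ℂ) (Θ₁ Θ₂ : Matrix (Fin n) (Fin p) ℂ) {y : ℝ}
    (hy : y ∈ Set.Ioo 0 (node l d (numVals d)) \ Set.range (node l d)) :
    HasDerivAt (fun y => (U l d β Θ₁ Θ₂ y)⁻¹)
      (-((U l d β Θ₁ Θ₂ y)⁻¹ * (B l d β Θ₁ Θ₂ y * C l d β Θ₁ Θ₂ y))) y := by
  obtain ⟨u, hu⟩ := isUnit_of_Jt_unitary (U_Jt l d β Θ₁ Θ₂ y)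
  have h := hasFDerivAt_ringInverse (𝕜 := ℝ) u
  rw [hu] at h
  have h2 := h.comp_hasDerivAt y (hasDerivAt_U hl hd β Θ₁ Θ₂ hy)
  have e : (fun y => (U l d β Θ₁ Θ₂ y)⁻¹) = Ring.inverse ∘ U l d β Θ₁ Θ₂ :=
    funext fun y => Matrix.nonsing_inv_eq_ringInverse _
  rw [e]
  refine h2.congr_deriv ?_
  have hi : U l d β Θ₁ Θ₂ y * (↑u⁻¹ : Matrix (Fin n ⊕ Fin n) (Fin n ⊕ Fin n) ℂ) = 1 := by
    rw [← hu, Units.mul_inv]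
  have hi' : (U l d β Θ₁ Θ₂ y)⁻¹ = (↑u⁻¹ : Matrix (Fin n ⊕ Fin n) (Fin n ⊕ Fin n) ℂ) :=
    Matrix.inv_eq_right_inv hi
  rw [hi']
  simp only [neg_apply, ContinuousLinearMap.mulLeftRight_apply]
  rw [Matrix.mul_assoc, Matrix.mul_assoc, hi, Matrix.mul_one]

end Deriv

/-! ### Measurable, locally bounded matrix functions -/

section LocBdd

variable {ι κ τ : Type*}

/-- A matrix function on the line whose entries are measurable, and bounded on every interval
`[-R, R]`. -/
def LocBdd (F : ℝ → Matrix ι κ ℂ) : Prop :=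
  (∀ i j, Measurable fun y => F y i j) ∧
    ∀ R : ℝ, ∃ M : ℝ, 0 ≤ M ∧ ∀ y, |y| ≤ R → ∀ i j, ‖F y i j‖ ≤ M

theorem LocBdd.neg {F : ℝ → Matrix ι κ ℂ} (hF : LocBdd F) : LocBdd fun y => -F y := by
  refine ⟨fun i j => (hF.1 i j).neg, fun R => ?_⟩
  obtain ⟨M, h0, hM⟩ := hF.2 R
  exact ⟨M, h0, fun y hy i j => by simpa using hM y hy i j⟩

theorem LocBdd.const [Fintype ι] [Fintype κ] (X : Matrix ι κ ℂ) : LocBdd fun _ => X := by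
  refine ⟨fun i j => measurable_const, fun R => ⟨∑ i, ∑ j, ‖X i j‖, by positivity, ?_⟩⟩
  intro y _ i j
  exact (Finset.single_le_sum (f := fun j => ‖X i j‖) (fun _ _ => norm_nonneg _)
      (Finset.mem_univ j)).trans
    (Finset.single_le_sum (f := fun i => ∑ j, ‖X i j‖)
      (fun _ _ => Finset.sum_nonneg fun _ _ => norm_nonneg _) (Finset.mem_univ i))

theorem LocBdd.mul [Fintype κ] {F : ℝ → Matrix ι κ ℂ} {G : ℝ → Matrix κ τ ℂ} (hF : LocBdd F)
    (hG : LocBdd G) : LocBdd fun y => F y * G y := by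
  refine ⟨fun i j => ?_, fun R => ?_⟩
  · simp only [Matrix.mul_apply]
    exact Finset.measurable_sum _ fun m _ => (hF.1 i m).mul (hG.1 m j)
  · obtain ⟨M, h0, hM⟩ := hF.2 R
    obtain ⟨M', h0', hM'⟩ := hG.2 R
    refine ⟨∑ _m : κ, M * M', by positivity, fun y hy i j => ?_⟩
    simp only [Matrix.mul_apply]
    refine (norm_sum_le _ _).trans (Finset.sum_le_sum fun m _ => ?_)
    rw [norm_mul]
    exact mul_le_mul (hM y hy i m) (hM' y hy m j) (norm_nonneg _) h0

theorem LocBdd.conjTranspose {F : ℝ → Matrix ι κ ℂ} (hF : LocBdd F) :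
    LocBdd fun y => (F y)ᴴ := by
  refine ⟨fun i j => ?_, fun R => ?_⟩
  · simp only [Matrix.conjTranspose_apply]
    exact continuous_star.measurable.comp (hF.1 j i)
  · obtain ⟨M, h0, hM⟩ := hF.2 R
    exact ⟨M, h0, fun y hy i j => by
      simp only [Matrix.conjTranspose_apply, norm_star]
      exact hM y hy j i⟩

/-- A function pieced together from finitely many continuous ones by a measurable choice. -/
theorem LocBdd.piecewise [Fintype ι] [Fintype κ] {f : ℕ → ℝ → Matrix ι κ ℂ}
    (hf : ∀ r, Continuous (f r)) {N : ℝ → ℕ} (hN : Measurable N) {m : ℕ} (hm : ∀ y, N y ≤ m) :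
    LocBdd fun y => f (N y) y := by
  refine ⟨fun i j => ?_, fun R => ?_⟩
  · have h : Measurable fun q : ℝ × ℕ => f q.2 q.1 i j :=
      measurable_from_prod_countable_left fun r => ((hf r).matrix_elem i j).measurable
    exact h.comp (measurable_id.prodMk hN)
  · have h : ∀ r i j, ∃ M : ℝ, ∀ y ∈ Set.Icc (-R) R, ‖f r y i j‖ ≤ M := fun r i j =>
      isCompact_Icc.exists_bound_of_continuousOn ((hf r).matrix_elem i j).continuousOn
    choose M hM using h
    refine ⟨∑ r ∈ Finset.range (m + 1), ∑ i, ∑ j, |M r i j|, by positivity, fun y hy i j => ?_⟩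
    refine (hM (N y) i j y (abs_le.1 hy)).trans ((le_abs_self _).trans ?_)
    refine (Finset.single_le_sum (f := fun j => |M (N y) i j|) (fun _ _ => abs_nonneg _)
      (Finset.mem_univ j)).trans ?_
    refine (Finset.single_le_sum (f := fun i => ∑ j, |M (N y) i j|)
      (fun _ _ => Finset.sum_nonneg fun _ _ => abs_nonneg _) (Finset.mem_univ i)).trans ?_
    exact Finset.single_le_sum (f := fun r => ∑ i, ∑ j, |M r i j|)
      (fun _ _ => by positivity) (Finset.mem_range.2 (Nat.lt_succ_of_le (hm y)))

end LocBdd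

theorem measurable_nodesPassed (l : ℝ) (d : Fin p → ℝ) : Measurable (nodesPassed l d) := by
  unfold nodesPassed
  simp only [Finset.card_filter]
  exact Finset.measurable_sum _ fun δ _ =>
    Measurable.ite measurableSet_Ici measurable_const measurable_const

section Coefficients

variable (l : ℝ) (d : Fin p → ℝ) (β : Matrix (Fin n) (Fin n) ℂ) (Θ₁ Θ₂ : Matrix (Fin n) (Fin p) ℂ)

theorem locBdd_U : LocBdd (U l d β Θ₁ Θ₂) :=
  LocBdd.piecewise (f := fun r y => transfer l d β Θ₁ Θ₂ (numVals d + 1 - r) y *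
    Unode l d β Θ₁ Θ₂ r) (fun _ => (continuous_transfer l d β Θ₁ Θ₂ _).matrix_mul
      continuous_const) (measurable_nodesPassed l d) (nodesPassed_le l d)

theorem locBdd_U_inv : LocBdd fun y => (U l d β Θ₁ Θ₂ y)⁻¹ := by
  simp only [inv_eq_of_Jt_unitary (U_Jt l d β Θ₁ Θ₂ _)]
  exact (((LocBdd.const _).mul (locBdd_U l d β Θ₁ Θ₂).conjTranspose).mul (LocBdd.const _)).neg

theorem locBdd_B : LocBdd (B l d β Θ₁ Θ₂) :=
  LocBdd.piecewise (f := fun r y => expA β (-y) * col Θ₁ Θ₂ * Dinv d * P d (numVals d + 1 - r))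
    (fun _ => ((((continuous_expA β).comp continuous_neg).matrix_mul continuous_const).matrix_mul
      continuous_const).matrix_mul continuous_const) (measurable_nodesPassed l d)
      (nodesPassed_le l d)

theorem locBdd_C : LocBdd (C l d β Θ₁ Θ₂) :=
  LocBdd.piecewise (f := fun r y => P d (numVals d + 1 - r) * row Θ₁ Θ₂ * expA β y)
    (fun _ => continuous_const.matrix_mul (continuous_expA β)) (measurable_nodesPassed l d)
      (nodesPassed_le l d)

end Coefficients

/-- The matrix `H(x) I - Q`, where `H` is the Heaviside function, with `H(0) = 0`. -/
noncomputable def jump {ι : Type*} [DecidableEq ι] (Q : Matrix ι ι ℂ) (x : ℝ) : Matrix ι ι ℂ :=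
  (if 0 < x then 1 else 0) - Q

/-- A semiseparable kernel `F(x) (H(x-t) - Q) G(t)` with locally bounded factors is a bounded
kernel. -/
theorem isBoundedKernel_semiseparable {ι : Type*} [Fintype ι] [DecidableEq ι] (b : ℝ)
    {F : ℝ → Matrix (Fin p) ι ℂ} {G : ℝ → Matrix ι (Fin p) ℂ} (hF : LocBdd F) (hG : LocBdd G)
    (Q : Matrix ι ι ℂ) : IsBoundedKernel b fun x t => F x * jump Q (x - t) * G t := by
  have hexp : ∀ x t i j, (F x * jump Q (x - t) * G t) i j =
      (if t < x then (∑ m, F x i m * G t m j) else 0) - ∑ m, (F x * Q) i m * G t m j := by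
    intro x t i j
    rw [jump, Matrix.mul_sub, Matrix.sub_mul, Matrix.sub_apply]
    congr 1
    simp only [sub_pos]
    split_ifs <;> simp [Matrix.mul_apply]
  have hFQ := hF.mul (LocBdd.const Q)
  refine ⟨fun i j => ?_, ?_⟩
  · simp only [hexp]
    refine Measurable.sub (Measurable.ite (measurableSet_lt measurable_snd measurable_fst) ?_
      measurable_const) ?_
    · exact Finset.measurable_sum _ fun m _ =>
        ((hF.1 i m).comp measurable_fst).mul ((hG.1 m j).comp measurable_snd)
    · exact Finset.measurable_sum _ fun m _ =>
        ((hFQ.1 i m).comp measurable_fst).mul ((hG.1 m j).comp measurable_snd)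
  · obtain ⟨M₁, h₁, hM₁⟩ := hF.2 b
    obtain ⟨M₂, h₂, hM₂⟩ := hFQ.2 b
    obtain ⟨M₃, h₃, hM₃⟩ := hG.2 b
    refine ⟨(∑ _m : ι, M₁ * M₃) + ∑ _m : ι, M₂ * M₃, fun x hx t ht i j => ?_⟩
    have hx' : |x| ≤ b := by rw [abs_of_pos hx.1]; exact hx.2.le
    have ht' : |t| ≤ b := by rw [abs_of_pos ht.1]; exact ht.2.le
    simp only [hexp]
    refine (norm_sub_le _ _).trans (add_le_add ?_ ?_)
    · have hs : ‖∑ m, F x i m * G t m j‖ ≤ ∑ _m : ι, M₁ * M₃ := by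
        refine (norm_sum_le _ _).trans (Finset.sum_le_sum fun m _ => ?_)
        rw [norm_mul]
        exact mul_le_mul (hM₁ x hx' i m) (hM₃ t ht' m j) (norm_nonneg _) h₁
      split_ifs
      · exact hs
      · rw [norm_zero]; positivity
    · refine (norm_sum_le _ _).trans (Finset.sum_le_sum fun m _ => ?_)
      rw [norm_mul]
      exact mul_le_mul (hM₂ x hx' i m) (hM₃ t ht' m j) (norm_nonneg _) h₂

/-! ### Integration across the jumps -/

section Jump

variable {ι κ τ : Type*} {μ : Measure ℝ}

/-- The matrix function `F` is integrable with integral `I`, entry by entry. -/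
def HasIntegral (μ : Measure ℝ) (F : ℝ → Matrix ι κ ℂ) (I : Matrix ι κ ℂ) : Prop :=
  ∀ i j, Integrable (fun y => F y i j) μ ∧ ∫ y, F y i j ∂μ = I i j

theorem HasIntegral.add {F G : ℝ → Matrix ι κ ℂ} {I I' : Matrix ι κ ℂ}
    (hF : HasIntegral μ F I) (hG : HasIntegral μ G I') :
    HasIntegral μ (fun y => F y + G y) (I + I') := fun i j =>
  ⟨(hF i j).1.add (hG i j).1, by
    simp only [Matrix.add_apply]
    rw [integral_add (hF i j).1 (hG i j).1, (hF i j).2, (hG i j).2]⟩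

theorem HasIntegral.sub {F G : ℝ → Matrix ι κ ℂ} {I I' : Matrix ι κ ℂ}
    (hF : HasIntegral μ F I) (hG : HasIntegral μ G I') :
    HasIntegral μ (fun y => F y - G y) (I - I') := fun i j =>
  ⟨(hF i j).1.sub (hG i j).1, by
    simp only [Matrix.sub_apply]
    rw [integral_sub (hF i j).1 (hG i j).1, (hF i j).2, (hG i j).2]⟩

theorem HasIntegral.const_mul [Fintype ι] (X : Matrix τ ι ℂ) {F : ℝ → Matrix ι κ ℂ}
    {I : Matrix ι κ ℂ} (hF : HasIntegral μ F I) : HasIntegral μ (fun y => X * F y) (X * I) :=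
  fun i j => by
    simp only [Matrix.mul_apply]
    have h : ∀ m, Integrable (fun y => X i m * F y m j) μ := fun m => (hF m j).1.const_mul _
    refine ⟨integrable_finsetSum _ fun m _ => h m, ?_⟩
    rw [integral_finsetSum _ fun m _ => h m]
    simp only [integral_const_mul, (hF _ j).2]

theorem HasIntegral.mul_const [Fintype κ] {F : ℝ → Matrix ι κ ℂ} {I : Matrix ι κ ℂ}
    (hF : HasIntegral μ F I) (X : Matrix κ τ ℂ) : HasIntegral μ (fun y => F y * X) (I * X) :=
  fun i j => by
    simp only [Matrix.mul_apply]
    have h : ∀ m, Integrable (fun y => F y i m * X m j) μ := fun m => (hF i m).1.mul_const _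
    refine ⟨integrable_finsetSum _ fun m _ => h m, ?_⟩
    rw [integral_finsetSum _ fun m _ => h m]
    simp only [integral_mul_const, (hF i _).2]

theorem HasIntegral.congr {F G : ℝ → Matrix ι κ ℂ} {I : Matrix ι κ ℂ} (hF : HasIntegral μ F I)
    (h : ∀ᵐ y ∂μ, F y = G y) : HasIntegral μ G I := fun i j => by
  have e : (fun y => F y i j) =ᵐ[μ] fun y => G y i j := by
    filter_upwards [h] with y hy
    rw [hy]
  exact ⟨(hF i j).1.congr e, by rw [← integral_congr_ae e, (hF i j).2]⟩

theorem LocBdd.integrableOn {F : ℝ → Matrix ι κ ℂ} (hF : LocBdd F) (a : ℝ) (i : ι) (j : κ) :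
    IntegrableOn (fun y => F y i j) (Set.Ioo 0 a) := by
  obtain ⟨M, h0, hM⟩ := hF.2 a
  refine Measure.integrableOn_of_bounded (M := M) (by simp) (hF.1 i j).aestronglyMeasurable ?_
  filter_upwards [ae_restrict_mem measurableSet_Ioo] with y hy
  exact hM y (by rw [abs_of_pos hy.1]; exact hy.2.le) i j

variable [Fintype ι] [DecidableEq ι]

/-- Integration of a derivative `W'` against two Heaviside factors. It is the reason why the
composition of two semiseparable kernels is semiseparable. -/
theorem hasIntegral_jump_mul_mul_jump {a : ℝ} {W W' : ℝ → Matrix ι ι ℂ} {s : Set ℝ}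
    (hs : s.Countable) (hW : ∀ i j, ContinuousOn (fun y => W y i j) (Set.Icc 0 a))
    (hd : ∀ y ∈ Set.Ioo 0 a \ s, ∀ i j, HasDerivAt (fun y => W y i j) (W' y i j) y)
    (hi : ∀ i j, IntegrableOn (fun y => W' y i j) (Set.Ioo 0 a))
    (Q R : Matrix ι ι ℂ) {x t : ℝ} (hx : x ∈ Set.Ioo 0 a) (ht : t ∈ Set.Ioo 0 a) :
    HasIntegral (vol a) (fun y => jump Q (x - y) * W' y * jump R (y - t))
      ((if t < x then W x - W t else 0) - (W x - W 0) * R - Q * (W a - W t) +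
        Q * (W a - W 0) * R) := by
  have ftc : ∀ u v, 0 ≤ u → u ≤ v → v ≤ a → ∀ i j,
      ∫ y in Set.Ioo u v, W' y i j = W v i j - W u i j := by
    intro u v hu huv hv i j
    rw [← integral_Ioc_eq_integral_Ioo, ← intervalIntegral.integral_of_le huv]
    refine integral_eq_of_hasDerivAt_off_countable_of_le (fun y => W y i j) (fun y => W' y i j)
      huv hs ((hW i j).mono (Set.Icc_subset_Icc hu hv)) ?_ ?_
    · intro y hy
      exact hd y ⟨⟨hu.trans_lt hy.1.1, hy.1.2.trans_le hv⟩, hy.2⟩ i j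
    · rw [intervalIntegrable_iff_integrableOn_Ioo_of_le huv]
      exact (hi i j).mono_set (Set.Ioo_subset_Ioo hu hv)
  have ha := hx.1.trans hx.2
  have hind : ∀ u v, 0 ≤ u → v ≤ a →
      HasIntegral (vol a) (fun y => if y ∈ Set.Ioo u v then W' y else 0)
        (if u < v then W v - W u else 0) := by
    intro u v hu hv i j
    have e : (fun y => (if y ∈ Set.Ioo u v then W' y else 0) i j) =
        (Set.Ioo u v).indicator fun y => W' y i j := by
      funext y
      by_cases h : y ∈ Set.Ioo u v <;> simp [h]
    rw [e]
    refine ⟨(hi i j).indicator measurableSet_Ioo, ?_⟩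
    rw [setIntegral_indicator measurableSet_Ioo,
      Set.inter_eq_right.2 (Set.Ioo_subset_Ioo hu hv)]
    split_ifs with h
    · exact ftc u v hu h.le hv i j
    · rw [Set.Ioo_eq_empty h]
      simp
  -- Expanding the two factors leaves `W'` on the intervals `(t,x)`, `(0,x)`, `(t,a)` and `(0,a)`.
  have i1 := hind t x ht.1.le hx.2.le
  have i2 := hind 0 x le_rfl hx.2.le
  have i3 := hind t a ht.1.le le_rfl
  have i4 := hind 0 a le_rfl le_rfl
  rw [if_pos hx.1] at i2
  rw [if_pos ht.2] at i3
  rw [if_pos ha] at i4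
  refine (((i1.sub (i2.mul_const R)).sub (i3.const_mul Q)).add
    ((i4.const_mul Q).mul_const R)).congr ?_
  filter_upwards [ae_restrict_mem measurableSet_Ioo] with y hy
  simp only [jump, sub_pos, Set.mem_Ioo, hy.1, hy.2, true_and, and_true, if_true]
  by_cases h1 : y < x <;> by_cases h2 : t < y <;> simp only [h1, h2, if_true, if_false,
    and_true, and_false] <;> noncomm_ring

end Jump

/-! ### Composition of integral operators -/

theorem coeFn_idPlus {b : ℝ} {K : ℝ → ℝ → Matrix (Fin p) (Fin p) ℂ} (hK : IsBoundedKernel b K)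
    (f : L2 p b) : idPlus b K hK f =ᵐ[vol b] fun x => f x + integralFun b K f x := by
  have h1 : idPlus b K hK f = f + (memLp_integralFun hK f).toLp (integralFun b K f) := rfl
  rw [h1]
  filter_upwards [Lp.coeFn_add f ((memLp_integralFun hK f).toLp (integralFun b K f)),
    (memLp_integralFun hK f).coeFn_toLp] with x hx hx'
  rw [hx, Pi.add_apply, hx']

theorem integrable_kernel_mul_kernel {b : ℝ} {K T : ℝ → ℝ → Matrix (Fin p) (Fin p) ℂ}
    (hK : IsBoundedKernel b K) (hT : IsBoundedKernel b T) {x t : ℝ} (hx : x ∈ Set.Ioo 0 b)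
    (ht : t ∈ Set.Ioo 0 b) (i m j : Fin p) :
    Integrable (fun s => K x s i m * T s t m j) (vol b) := by
  obtain ⟨M, hM⟩ := hK.2
  obtain ⟨M', hM'⟩ := hT.2
  refine Measure.integrableOn_of_bounded (M := |M| * |M'|) (by simp) ?_ ?_
  · exact (((hK.1 i m).comp measurable_prodMk_left).mul
      ((hT.1 m j).comp measurable_prodMk_right)).aestronglyMeasurable
  · filter_upwards [ae_restrict_mem measurableSet_Ioo] with s hs
    rw [norm_mul]
    exact mul_le_mul ((hM x hx s hs i m).trans (le_abs_self _))
      ((hM' s hs t ht m j).trans (le_abs_self _)) (norm_nonneg _) (abs_nonneg _)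

theorem integrable_kernel_mul_kernel_mul {b : ℝ} {K T : ℝ → ℝ → Matrix (Fin p) (Fin p) ℂ}
    (hK : IsBoundedKernel b K) (hT : IsBoundedKernel b T) (f : L2 p b) {x : ℝ}
    (hx : x ∈ Set.Ioo 0 b) (i m j : Fin p) :
    Integrable (fun q : ℝ × ℝ => K x q.1 i m * (T q.1 q.2 m j * f q.2 j))
      ((vol b).prod (vol b)) := by
  obtain ⟨M, hM⟩ := hK.2
  obtain ⟨M', hM'⟩ := hT.2
  have h : Integrable (fun q : ℝ × ℝ => f q.2 j) ((vol b).prod (vol b)) :=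
    (integrable_coord f j).comp_snd _
  have h2 := h.bdd_mul (c := |M| * |M'|) (f := fun q : ℝ × ℝ => K x q.1 i m * T q.1 q.2 m j)
    ?_ ?_
  · simpa only [mul_assoc] using h2
  · have h1 : Measurable fun q : ℝ × ℝ => K x q.1 i m :=
      (hK.1 i m).comp (measurable_const.prodMk measurable_fst)
    exact (h1.mul (hT.1 m j)).aestronglyMeasurable
  · rw [Measure.prod_restrict]
    filter_upwards [ae_restrict_mem (measurableSet_Ioo.prod measurableSet_Ioo)] with q hq
    rw [norm_mul]
    exact mul_le_mul ((hM x hx q.1 hq.1 i m).trans (le_abs_self _))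
      ((hM' q.1 hq.1 q.2 hq.2 m j).trans (le_abs_self _)) (norm_nonneg _) (abs_nonneg _)

/-- If `K + T + K ∘ T = 0` holds for the kernels, then `(I + K)(I + T) = I`. -/
theorem idPlus_mul_idPlus {b : ℝ} {K T : ℝ → ℝ → Matrix (Fin p) (Fin p) ℂ}
    (hK : IsBoundedKernel b K) (hT : IsBoundedKernel b T)
    (h : ∀ x ∈ Set.Ioo 0 b, ∀ t ∈ Set.Ioo 0 b, ∀ i j,
      ∫ s in Set.Ioo 0 b, (K x s * T s t) i j = -(K x t i j + T x t i j)) :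
    idPlus b K hK * idPlus b T hT = 1 := by
  ext1 f
  refine Lp.ext ?_
  rw [mul_apply_eq_comp, one_apply_eq_self]
  have hT' := coeFn_idPlus hT f
  filter_upwards [coeFn_idPlus hK (idPlus b T hT f), hT', ae_restrict_mem measurableSet_Ioo]
    with x h1 h2 hx
  rw [h1, h2]
  ext i
  simp only [integralFun, PiLp.add_apply]
  have e1 : ∀ m, ∫ s in Set.Ioo 0 b, K x s i m * (idPlus b T hT f) s m =
      (∫ s in Set.Ioo 0 b, K x s i m * f s m) +
        ∑ j, ∫ t in Set.Ioo 0 b, (∫ s in Set.Ioo 0 b, K x s i m * T s t m j) * f t j := by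
    intro m
    have hj : ∀ j, Integrable (fun s => ∫ t in Set.Ioo 0 b, K x s i m * (T s t m j * f t j))
        (vol b) := fun j =>
      (integrable_kernel_mul_kernel_mul hK hT f hx i m j).integral_prod_left
    have e2 : ∫ s in Set.Ioo 0 b, K x s i m * (idPlus b T hT f) s m =
        ∫ s in Set.Ioo 0 b, (K x s i m * f s m +
          ∑ j, ∫ t in Set.Ioo 0 b, K x s i m * (T s t m j * f t j)) := by
      refine integral_congr_ae ?_
      filter_upwards [hT'] with s hs
      rw [hs]
      simp only [integralFun, PiLp.add_apply, mul_add, Finset.mul_sum, integral_const_mul]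
    rw [e2, integral_add (integrable_kernel_mul hK f hx i m)
      (integrable_finsetSum _ fun j _ => hj j), integral_finsetSum _ fun j _ => hj j]
    congr 1
    refine Finset.sum_congr rfl fun j _ => ?_
    rw [integral_integral_swap (integrable_kernel_mul_kernel_mul hK hT f hx i m j)]
    refine integral_congr_ae (Filter.Eventually.of_forall fun t => ?_)
    simp only [← mul_assoc, integral_mul_const]
  simp only [e1, Finset.sum_add_distrib]
  rw [Finset.sum_comm]
  have hint : ∀ m j, Integrable
      (fun t => (∫ s in Set.Ioo 0 b, K x s i m * T s t m j) * f t j) (vol b) := by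
    intro m j
    have := (integrable_kernel_mul_kernel_mul hK hT f hx i m j).integral_prod_right
    refine this.congr (Filter.Eventually.of_forall fun t => ?_)
    simp only [← mul_assoc, integral_mul_const]
  have e3 : ∀ j, ∑ m, ∫ t in Set.Ioo 0 b, (∫ s in Set.Ioo 0 b, K x s i m * T s t m j) * f t j =
      -(∫ t in Set.Ioo 0 b, K x t i j * f t j) - ∫ t in Set.Ioo 0 b, T x t i j * f t j := by
    intro j
    rw [← integral_finsetSum _ fun m _ => hint m j, ← neg_add', ← integral_add
      (integrable_kernel_mul hK f hx i j) (integrable_kernel_mul hT f hx i j), ← integral_neg]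
    refine integral_congr_ae ?_
    filter_upwards [ae_restrict_mem measurableSet_Ioo] with t ht
    have h3 := h x hx t ht i j
    simp only [Matrix.mul_apply] at h3
    rw [integral_finsetSum _ fun m _ => integrable_kernel_mul_kernel hK hT hx ht i m j] at h3
    rw [← Finset.sum_mul, h3]
    ring
  simp only [e3, Finset.sum_sub_distrib, Finset.sum_neg_distrib]
  ring

/-! ### The inverse of `S̃` -/

/-- The projector `diag(0, I)`. With it, the kernel of `S̃` is `-C(y) (H(y-z) - P) B(z)`. -/
def Plow (n : ℕ) : Matrix (Fin n ⊕ Fin n) (Fin n ⊕ Fin n) ℂ := Matrix.fromBlocks 0 0 0 1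

theorem one_sub_Plow (n : ℕ) : 1 - Plow n = Matrix.fromBlocks 1 0 0 0 := by
  rw [sub_eq_iff_eq_add, Plow, Matrix.fromBlocks_add, ← Matrix.fromBlocks_one]
  simp

theorem Plow_mul_Px (X : Matrix (Fin n ⊕ Fin n) (Fin n ⊕ Fin n) ℂ) :
    Plow n * Px X = Px X := by
  rw [Plow, Px, Matrix.fromBlocks_multiply]
  simp

theorem Px_mul_Plow (X : Matrix (Fin n ⊕ Fin n) (Fin n ⊕ Fin n) ℂ) :
    Px X * Plow n = Plow n := by
  rw [Plow, Px, Matrix.fromBlocks_multiply]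
  simp

theorem Px_eq_mul {X : Matrix (Fin n ⊕ Fin n) (Fin n ⊕ Fin n) ℂ}
    (hX : X.toBlocks₂₂.det ≠ 0) :
    Px X = Matrix.fromBlocks 0 0 0 X.toBlocks₂₂⁻¹ * X := by
  conv_rhs => rw [← Matrix.fromBlocks_toBlocks X]
  rw [Px, Matrix.fromBlocks_multiply]
  simp [Matrix.nonsing_inv_mul _ (Ne.isUnit hX)]

/-- The lower rows of `X (I - P^×)` vanish. -/
theorem Plow_mul_mul_Px {X : Matrix (Fin n ⊕ Fin n) (Fin n ⊕ Fin n) ℂ}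
    (hX : X.toBlocks₂₂.det ≠ 0) : Plow n * X * Px X = Plow n * X := by
  conv_lhs => enter [1, 2]; rw [← Matrix.fromBlocks_toBlocks X]
  conv_rhs => rw [← Matrix.fromBlocks_toBlocks X]
  rw [Plow, Px, Matrix.fromBlocks_multiply, Matrix.fromBlocks_multiply]
  simp [Matrix.mul_nonsing_inv_cancel_left _ _ (Ne.isUnit hX)]

/-- The left columns of `P^× X⁻¹` vanish. -/
theorem Px_mul_inv_mul_Plow {X : Matrix (Fin n ⊕ Fin n) (Fin n ⊕ Fin n) ℂ} (h : IsUnit X)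
    (hX : X.toBlocks₂₂.det ≠ 0) : Px X * X⁻¹ * Plow n = Px X * X⁻¹ := by
  have e : Px X * X⁻¹ = Matrix.fromBlocks 0 0 0 X.toBlocks₂₂⁻¹ := by
    rw [Px_eq_mul hX, Matrix.mul_assoc,
      Matrix.mul_nonsing_inv _ ((Matrix.isUnit_iff_isUnit_det X).1 h), Matrix.mul_one]
  rw [e, Plow, Matrix.fromBlocks_multiply]
  simp

theorem exp_fromBlocks_diagonal (X Y : Matrix (Fin n) (Fin n) ℂ) :
    NormedSpace.exp (Matrix.fromBlocks X 0 0 Y) =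
      Matrix.fromBlocks (NormedSpace.exp X) 0 0 (NormedSpace.exp Y) := by
  let _ : NormedRing (Matrix (Fin n) (Fin n) ℂ) := Matrix.linftyOpNormedRing
  let _ : NormedAlgebra ℂ (Matrix (Fin n) (Fin n) ℂ) := Matrix.linftyOpNormedAlgebra
  let _ : NormedAlgebra ℚ (Matrix (Fin n) (Fin n) ℂ) := NormedAlgebra.restrictScalars ℚ ℂ _
  let _ : NormedRing (Matrix (Fin n ⊕ Fin n) (Fin n ⊕ Fin n) ℂ) := Matrix.linftyOpNormedRing
  let φ : Matrix (Fin n) (Fin n) ℂ × Matrix (Fin n) (Fin n) ℂ →+*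
      Matrix (Fin n ⊕ Fin n) (Fin n ⊕ Fin n) ℂ :=
    { toFun := fun q => Matrix.fromBlocks q.1 0 0 q.2
      map_one' := Matrix.fromBlocks_one
      map_mul' := fun q r => by simp [Matrix.fromBlocks_multiply]
      map_zero' := Matrix.fromBlocks_zero
      map_add' := fun q r => by simp [Matrix.fromBlocks_add] }
  have hφ : Continuous φ :=
    continuous_fst.matrix_fromBlocks continuous_const continuous_const continuous_snd
  have h : φ (NormedSpace.exp (X, Y)) = NormedSpace.exp (φ (X, Y)) :=
    NormedSpace.map_exp φ hφ (X, Y)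
  have h1 := Prod.fst_exp (X, Y)
  have h2 := Prod.snd_exp (X, Y)
  exact (h.symm.trans (congrArg₂ (fun a b => Matrix.fromBlocks a 0 0 b) h1 h2))

theorem expA_eq (β : Matrix (Fin n) (Fin n) ℂ) (y : ℝ) :
    expA β y = Matrix.fromBlocks (NormedSpace.exp ((Complex.I * (y : ℂ)) • βᴴ)) 0 0
      (NormedSpace.exp ((Complex.I * (y : ℂ)) • β)) := by
  rw [expA, A, smul_smul, mul_comm, Matrix.fromBlocks_smul]
  simp only [smul_zero]
  exact exp_fromBlocks_diagonal _ _

/-- The two diagonal blocks of `e^{y𝒜}` give the values of `k` on the two half lines. At `x = 0`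
both sides take the value of the branch `x < 0`. -/
theorem k_eq_row_mul_jump_mul_col (β : Matrix (Fin n) (Fin n) ℂ)
    (Θ₁ Θ₂ : Matrix (Fin n) (Fin p) ℂ) (x : ℝ) :
    k β Θ₁ Θ₂ x = -(row Θ₁ Θ₂ * jump (Plow n) x * expA β x * col Θ₁ Θ₂) := by
  rw [expA_eq, row, col, jump, k]
  split_ifs with h
  · rw [one_sub_Plow, Matrix.fromCols_mul_fromBlocks,
      Matrix.fromCols_mul_fromBlocks, Matrix.fromCols_mul_fromRows]
    simp
  · rw [zero_sub, Plow, Matrix.fromBlocks_neg, Matrix.fromCols_mul_fromBlocks,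
      Matrix.fromCols_mul_fromBlocks, Matrix.fromCols_mul_fromRows]
    simp only [Matrix.conjTranspose_mul, ← Matrix.exp_conjTranspose, Matrix.conjTranspose_smul]
    simp [Matrix.mul_assoc]

theorem jump_Plow_comm_expA (β : Matrix (Fin n) (Fin n) ℂ) (x y : ℝ) :
    jump (Plow n) x * expA β y = expA β y * jump (Plow n) x := by
  rw [expA_eq, jump]
  split_ifs
  · rw [one_sub_Plow, Matrix.fromBlocks_multiply,
      Matrix.fromBlocks_multiply]
    simp
  · rw [zero_sub, Plow, Matrix.fromBlocks_neg, Matrix.fromBlocks_multiply,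
      Matrix.fromBlocks_multiply]
    simp

theorem expA_sub (β : Matrix (Fin n) (Fin n) ℂ) (y z : ℝ) :
    expA β (y - z) = expA β y * expA β (-z) := by
  rw [expA, expA, expA, ← Matrix.exp_add_of_commute, ← add_smul]
  · push_cast
    rw [sub_eq_add_neg]
  · exact ((Commute.refl (A β)).smul_left _).smul_right _

/-- The kernel of `S̃` in semiseparable form. -/
theorem kernelSt_eq {l : ℝ} (hl : 0 < l) {d : Fin p → ℝ} (hd : ∀ i, 0 < d i)
    (β : Matrix (Fin n) (Fin n) ℂ) (Θ₁ Θ₂ : Matrix (Fin n) (Fin p) ℂ) (y z : ℝ) :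
    kernelSt l d β Θ₁ Θ₂ y z =
      -(C l d β Θ₁ Θ₂ y * jump (Plow n) (y - z) * B l d β Θ₁ Θ₂ z) := by
  have e : -(C l d β Θ₁ Θ₂ y * jump (Plow n) (y - z) * B l d β Θ₁ Θ₂ z) =
      P d (idx l d y) * (k β Θ₁ Θ₂ (y - z) * (Dinv d * P d (idx l d z))) := by
    rw [k_eq_row_mul_jump_mul_col β Θ₁ Θ₂, C, B, expA_sub]
    simp only [Matrix.neg_mul, Matrix.mul_neg, neg_inj]
    calc _ = P d (idx l d y) * row Θ₁ Θ₂ * (expA β y * jump (Plow n) (y - z)) * expA β (-z) *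
          col Θ₁ Θ₂ * Dinv d * P d (idx l d z) := by simp only [Matrix.mul_assoc]
      _ = _ := by rw [← jump_Plow_comm_expA]; simp only [Matrix.mul_assoc]
  rw [e, P_idx hl hd y, P_idx hl hd z, Dinv, Matrix.diagonal_mul_diagonal]
  ext i j
  rw [Matrix.diagonal_mul, Matrix.mul_diagonal]
  simp only [kernelSt, Matrix.of_apply]
  by_cases h1 : y < d i * l <;> by_cases h2 : z < d j * l <;>
    simp [h1, h2, mul_comm (k β Θ₁ Θ₂ (y - z) i j)]

theorem kernelT_eq [NeZero p] (l : ℝ) (d : Fin p → ℝ) (β : Matrix (Fin n) (Fin n) ℂ)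
    (Θ₁ Θ₂ : Matrix (Fin n) (Fin p) ℂ) (y z : ℝ) :
    kernelT l d β Θ₁ Θ₂ y z = C l d β Θ₁ Θ₂ y * U l d β Θ₁ Θ₂ y *
      jump (Px (U l d β Θ₁ Θ₂ (d 0 * l))) (y - z) *
        ((U l d β Θ₁ Θ₂ z)⁻¹ * B l d β Θ₁ Θ₂ z) := by
  rw [kernelT, jump]
  simp only [sub_pos]
  split_ifs
  · simp only [Matrix.mul_assoc]
  · rw [zero_sub, Matrix.mul_neg, Matrix.neg_mul]
    simp only [Matrix.mul_assoc]

theorem isBoundedKernel_kernelT [NeZero p] (l : ℝ) (d : Fin p → ℝ) (β : Matrix (Fin n) (Fin n) ℂ)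
    (Θ₁ Θ₂ : Matrix (Fin n) (Fin p) ℂ) (a : ℝ) :
    IsBoundedKernel a (kernelT l d β Θ₁ Θ₂) := by
  have h := isBoundedKernel_semiseparable a
    ((locBdd_C l d β Θ₁ Θ₂).mul (locBdd_U l d β Θ₁ Θ₂))
    ((locBdd_U_inv l d β Θ₁ Θ₂).mul (locBdd_B l d β Θ₁ Θ₂)) (Px (U l d β Θ₁ Θ₂ (d 0 * l)))
  have e : kernelT l d β Θ₁ Θ₂ = fun y z => C l d β Θ₁ Θ₂ y * U l d β Θ₁ Θ₂ y *
      jump (Px (U l d β Θ₁ Θ₂ (d 0 * l))) (y - z) *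
        ((U l d β Θ₁ Θ₂ z)⁻¹ * B l d β Θ₁ Θ₂ z) :=
    funext₂ fun y z => kernelT_eq l d β Θ₁ Θ₂ y z
  rw [e]
  exact h

/-- Passing from the derivative of a matrix function to the derivatives of its entries. -/
theorem hasDerivAt_entry {m : Type*} [Fintype m] [DecidableEq m] {W : ℝ → Matrix m m ℂ}
    {W' : Matrix m m ℂ} {y : ℝ} (h : HasDerivAt W W' y) (i j : m) :
    HasDerivAt (fun y => W y i j) (W' i j) y := by
  have h1 : HasDerivAt (F := m → m → ℂ) W W' y := h
  exact hasDerivAt_pi.1 (hasDerivAt_pi.1 h1 i) j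

theorem U_mul_inv (l : ℝ) (d : Fin p → ℝ) (β : Matrix (Fin n) (Fin n) ℂ)
    (Θ₁ Θ₂ : Matrix (Fin n) (Fin p) ℂ) (y : ℝ) :
    U l d β Θ₁ Θ₂ y * (U l d β Θ₁ Θ₂ y)⁻¹ = 1 :=
  Matrix.mul_nonsing_inv _
    ((Matrix.isUnit_iff_isUnit_det _).1 (isUnit_of_Jt_unitary (U_Jt l d β Θ₁ Θ₂ y)))

/-- The integral of `(H - P) U' (H - P^×)`, which governs the composition of `S̃` with `T̃`. The
boundary terms at `a` cancel because the lower rows of `U(a) (I - P^×)` vanish. -/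
theorem hasIntegral_jump_U [NeZero p] {l : ℝ} (hl : 0 < l) {d : Fin p → ℝ}
    (hd : ∀ i, 0 < d i) (hanti : Antitone d) (β : Matrix (Fin n) (Fin n) ℂ)
    (Θ₁ Θ₂ : Matrix (Fin n) (Fin p) ℂ) (hdet : (U l d β Θ₁ Θ₂ (d 0 * l)).toBlocks₂₂.det ≠ 0)
    {x t : ℝ}
    (hx : x ∈ Set.Ioo 0 (d 0 * l)) (ht : t ∈ Set.Ioo 0 (d 0 * l)) :
    HasIntegral (vol (d 0 * l)) (fun s => jump (Plow n) (x - s) *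
        (B l d β Θ₁ Θ₂ s * C l d β Θ₁ Θ₂ s * U l d β Θ₁ Θ₂ s) *
        jump (Px (U l d β Θ₁ Θ₂ (d 0 * l))) (s - t))
      (U l d β Θ₁ Θ₂ x * jump (Px (U l d β Θ₁ Θ₂ (d 0 * l))) (x - t) -
        jump (Plow n) (x - t) * U l d β Θ₁ Θ₂ t) := by
  have hnode := node_numVals l hd hanti
  have hc := continuousOn_U hl hd β Θ₁ Θ₂
  have hder := fun y hy => hasDerivAt_U hl hd β Θ₁ Θ₂ (y := y) hy
  rw [hnode] at hc hder
  have h := hasIntegral_jump_mul_mul_jump (W := U l d β Θ₁ Θ₂) (Set.countable_range (node l d))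
    (fun i j => (continuous_id.matrix_elem i j).comp_continuousOn hc)
    (fun y hy i j => hasDerivAt_entry (hder y hy) i j)
    (fun i j => (((locBdd_B l d β Θ₁ Θ₂).mul (locBdd_C l d β Θ₁ Θ₂)).mul
      (locBdd_U l d β Θ₁ Θ₂)).integrableOn _ i j)
    (Plow n) (Px (U l d β Θ₁ Θ₂ (d 0 * l))) hx ht
  convert h using 1
  have e1 := Plow_mul_mul_Px hdet
  have e2 := Plow_mul_Px (U l d β Θ₁ Θ₂ (d 0 * l))
  rw [U_zero hl hd]
  simp only [mul_sub, sub_mul, Matrix.mul_one, Matrix.one_mul, e1, e2, jump, sub_pos]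
  split_ifs <;> noncomm_ring

/-- The integral of `(H - P^×) (U⁻¹)' (H - P)`, which governs the composition of `T̃` with
`S̃`. -/
theorem hasIntegral_jump_U_inv [NeZero p] {l : ℝ} (hl : 0 < l) {d : Fin p → ℝ}
    (hd : ∀ i, 0 < d i) (hanti : Antitone d) (β : Matrix (Fin n) (Fin n) ℂ)
    (Θ₁ Θ₂ : Matrix (Fin n) (Fin p) ℂ) (hdet : (U l d β Θ₁ Θ₂ (d 0 * l)).toBlocks₂₂.det ≠ 0)
    {x t : ℝ}
    (hx : x ∈ Set.Ioo 0 (d 0 * l)) (ht : t ∈ Set.Ioo 0 (d 0 * l)) :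
    HasIntegral (vol (d 0 * l)) (fun s => jump (Px (U l d β Θ₁ Θ₂ (d 0 * l))) (x - s) *
        (-((U l d β Θ₁ Θ₂ s)⁻¹ * (B l d β Θ₁ Θ₂ s * C l d β Θ₁ Θ₂ s))) *
        jump (Plow n) (s - t))
      ((U l d β Θ₁ Θ₂ x)⁻¹ * jump (Plow n) (x - t) -
        jump (Px (U l d β Θ₁ Θ₂ (d 0 * l))) (x - t) * (U l d β Θ₁ Θ₂ t)⁻¹) := by
  have hnode := node_numVals l hd hanti
  have hc := continuousOn_U_inv hl hd β Θ₁ Θ₂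
  have hder := fun y hy => hasDerivAt_U_inv hl hd β Θ₁ Θ₂ (y := y) hy
  rw [hnode] at hc hder
  have h := hasIntegral_jump_mul_mul_jump (W := fun y => (U l d β Θ₁ Θ₂ y)⁻¹)
    (Set.countable_range (node l d))
    (fun i j => (continuous_id.matrix_elem i j).comp_continuousOn hc)
    (fun y hy i j => hasDerivAt_entry (hder y hy) i j)
    (fun i j => ((locBdd_U_inv l d β Θ₁ Θ₂).mul ((locBdd_B l d β Θ₁ Θ₂).mul
      (locBdd_C l d β Θ₁ Θ₂))).neg.integrableOn _ i j)
    (Px (U l d β Θ₁ Θ₂ (d 0 * l))) (Plow n) hx ht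
  convert h using 1
  have e1 := Px_mul_inv_mul_Plow (isUnit_of_Jt_unitary (U_Jt l d β Θ₁ Θ₂ (d 0 * l))) hdet
  have e2 := Px_mul_Plow (U l d β Θ₁ Θ₂ (d 0 * l))
  simp only [U_zero hl hd, inv_one]
  simp only [mul_sub, sub_mul, Matrix.mul_one, Matrix.one_mul, e1, e2, jump, sub_pos]
  split_ifs <;> noncomm_ring

theorem idPlus_kernelSt_mul_idPlus_kernelT [NeZero p] {l : ℝ} (hl : 0 < l) {d : Fin p → ℝ}
    (hd : ∀ i, 0 < d i) (hanti : Antitone d) (β : Matrix (Fin n) (Fin n) ℂ)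
    (Θ₁ Θ₂ : Matrix (Fin n) (Fin p) ℂ) (hdet : (U l d β Θ₁ Θ₂ (d 0 * l)).toBlocks₂₂.det ≠ 0) :
    idPlus (d 0 * l) (kernelSt l d β Θ₁ Θ₂) (isBoundedKernel_kernelSt l d β Θ₁ Θ₂ _) *
      idPlus (d 0 * l) (kernelT l d β Θ₁ Θ₂) (isBoundedKernel_kernelT l d β Θ₁ Θ₂ _) = 1 := by
  refine idPlus_mul_idPlus _ _ fun x hx t ht i j => ?_
  have h := ((hasIntegral_jump_U hl hd hanti β Θ₁ Θ₂ hdet hx ht).const_mul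
    (-C l d β Θ₁ Θ₂ x)).mul_const ((U l d β Θ₁ Θ₂ t)⁻¹ * B l d β Θ₁ Θ₂ t)
  have e : ∀ s, -C l d β Θ₁ Θ₂ x * (jump (Plow n) (x - s) *
      (B l d β Θ₁ Θ₂ s * C l d β Θ₁ Θ₂ s * U l d β Θ₁ Θ₂ s) *
        jump (Px (U l d β Θ₁ Θ₂ (d 0 * l))) (s - t)) *
        ((U l d β Θ₁ Θ₂ t)⁻¹ * B l d β Θ₁ Θ₂ t) =
      kernelSt l d β Θ₁ Θ₂ x s * kernelT l d β Θ₁ Θ₂ s t := by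
    intro s
    rw [kernelSt_eq hl hd, kernelT_eq]
    simp only [Matrix.mul_assoc, Matrix.neg_mul]
  rw [((h.congr (Filter.Eventually.of_forall e)) i j).2, kernelSt_eq hl hd, kernelT_eq,
    ← Matrix.add_apply, ← Matrix.neg_apply]
  refine congrFun (congrFun ?_ i) j
  calc _ = C l d β Θ₁ Θ₂ x * jump (Plow n) (x - t) *
        (U l d β Θ₁ Θ₂ t * (U l d β Θ₁ Θ₂ t)⁻¹) * B l d β Θ₁ Θ₂ t -
        C l d β Θ₁ Θ₂ x * U l d β Θ₁ Θ₂ x * jump (Px (U l d β Θ₁ Θ₂ (d 0 * l))) (x - t) *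
        ((U l d β Θ₁ Θ₂ t)⁻¹ * B l d β Θ₁ Θ₂ t) := by
        simp only [Matrix.mul_assoc, Matrix.neg_mul, Matrix.mul_sub, Matrix.sub_mul]
        abel
    _ = _ := by
        rw [U_mul_inv, Matrix.mul_one]
        abel

theorem idPlus_kernelT_mul_idPlus_kernelSt [NeZero p] {l : ℝ} (hl : 0 < l) {d : Fin p → ℝ}
    (hd : ∀ i, 0 < d i) (hanti : Antitone d) (β : Matrix (Fin n) (Fin n) ℂ)
    (Θ₁ Θ₂ : Matrix (Fin n) (Fin p) ℂ) (hdet : (U l d β Θ₁ Θ₂ (d 0 * l)).toBlocks₂₂.det ≠ 0) :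
    idPlus (d 0 * l) (kernelT l d β Θ₁ Θ₂) (isBoundedKernel_kernelT l d β Θ₁ Θ₂ _) *
      idPlus (d 0 * l) (kernelSt l d β Θ₁ Θ₂) (isBoundedKernel_kernelSt l d β Θ₁ Θ₂ _) = 1 := by
  refine idPlus_mul_idPlus _ _ fun x hx t ht i j => ?_
  have h := ((hasIntegral_jump_U_inv hl hd hanti β Θ₁ Θ₂ hdet hx ht).const_mul
    (C l d β Θ₁ Θ₂ x * U l d β Θ₁ Θ₂ x)).mul_const (B l d β Θ₁ Θ₂ t)
  have e : ∀ s, C l d β Θ₁ Θ₂ x * U l d β Θ₁ Θ₂ x *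
      (jump (Px (U l d β Θ₁ Θ₂ (d 0 * l))) (x - s) *
        (-((U l d β Θ₁ Θ₂ s)⁻¹ * (B l d β Θ₁ Θ₂ s * C l d β Θ₁ Θ₂ s))) *
        jump (Plow n) (s - t)) * B l d β Θ₁ Θ₂ t =
      kernelT l d β Θ₁ Θ₂ x s * kernelSt l d β Θ₁ Θ₂ s t := by
    intro s
    rw [kernelSt_eq hl hd, kernelT_eq]
    simp only [Matrix.mul_assoc, Matrix.neg_mul, Matrix.mul_neg]
  rw [((h.congr (Filter.Eventually.of_forall e)) i j).2, kernelSt_eq hl hd, kernelT_eq,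
    ← Matrix.add_apply, ← Matrix.neg_apply]
  refine congrFun (congrFun ?_ i) j
  calc _ = C l d β Θ₁ Θ₂ x * (U l d β Θ₁ Θ₂ x * (U l d β Θ₁ Θ₂ x)⁻¹) * jump (Plow n) (x - t) *
        B l d β Θ₁ Θ₂ t -
        C l d β Θ₁ Θ₂ x * U l d β Θ₁ Θ₂ x * jump (Px (U l d β Θ₁ Θ₂ (d 0 * l))) (x - t) *
        ((U l d β Θ₁ Θ₂ t)⁻¹ * B l d β Θ₁ Θ₂ t) := by
        simp only [Matrix.mul_assoc, Matrix.mul_sub, Matrix.sub_mul]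
    _ = _ := by
        rw [U_mul_inv, Matrix.mul_one]
        abel

/-! ### Self-adjointness of `S` -/

theorem integrable_kernel_form {b : ℝ} {K : ℝ → ℝ → Matrix (Fin p) (Fin p) ℂ}
    (hK : IsBoundedKernel b K) (f g : L2 p b) (i j : Fin p) :
    Integrable (fun q : ℝ × ℝ => K q.1 q.2 i j * (star (f q.1 i) * g q.2 j))
      ((vol b).prod (vol b)) := by
  obtain ⟨M, hM⟩ := hK.2
  have hf : Integrable (fun x => star (f x i)) (vol b) :=
    (memLp_one_iff_integrable.2 (integrable_coord f i)).star.integrable le_rfl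
  refine (hf.mul_prod (integrable_coord g j)).bdd_mul (c := M) (hK.1 i j).aestronglyMeasurable ?_
  rw [Measure.prod_restrict]
  filter_upwards [ae_restrict_mem (measurableSet_Ioo.prod measurableSet_Ioo)] with q hq
  exact hM q.1 hq.1 q.2 hq.2 i j

/-- The sesquilinear form of an integral operator as a sum of double integrals. -/
theorem inner_idPlus {b : ℝ} {K : ℝ → ℝ → Matrix (Fin p) (Fin p) ℂ}
    (hK : IsBoundedKernel b K) (f g : L2 p b) :
    inner ℂ f (idPlus b K hK g) = inner ℂ f g +
      ∑ i, ∑ j, ∫ q : ℝ × ℝ, K q.1 q.2 i j * (star (f q.1 i) * g q.2 j)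
        ∂((vol b).prod (vol b)) := by
  have h1 : idPlus b K hK g = g + (memLp_integralFun hK g).toLp (integralFun b K g) := rfl
  rw [h1, inner_add_right]
  congr 1
  have e : ∫ x, inner ℂ (f x) ((memLp_integralFun hK g).toLp (integralFun b K g) x) ∂(vol b) =
      ∫ x, ∑ i, ∑ j, ∫ t, K x t i j * (star (f x i) * g t j) ∂(vol b) ∂(vol b) := by
    refine integral_congr_ae ?_
    filter_upwards [(memLp_integralFun hK g).coeFn_toLp] with x hx
    rw [hx, PiLp.inner_apply]
    refine Finset.sum_congr rfl fun i _ => ?_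
    simp only [integralFun, RCLike.inner_apply, Finset.sum_mul]
    refine Finset.sum_congr rfl fun j _ => ?_
    rw [← integral_mul_const]
    refine integral_congr_ae (Filter.Eventually.of_forall fun t => ?_)
    simp only [starRingEnd_apply]
    ring
  have hint : ∀ i j, Integrable (fun x => ∫ t, K x t i j * (star (f x i) * g t j) ∂(vol b))
      (vol b) := fun i j => (integrable_kernel_form hK f g i j).integral_prod_left
  rw [L2.inner_def, e, integral_finsetSum _ fun i _ => integrable_finsetSum _ fun j _ => hint i j]
  refine Finset.sum_congr rfl fun i _ => ?_
  rw [integral_finsetSum _ fun j _ => hint i j]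
  refine Finset.sum_congr rfl fun j _ => ?_
  rw [integral_prod _ (integrable_kernel_form hK f g i j)]

/-- An integral operator with Hermitian kernel is self-adjoint. -/
theorem isSelfAdjoint_idPlus {b : ℝ} {K : ℝ → ℝ → Matrix (Fin p) (Fin p) ℂ}
    (hK : IsBoundedKernel b K) (h : ∀ x, ∀ᵐ t ∂(vol b), (K t x)ᴴ = K x t) :
    IsSelfAdjoint (idPlus b K hK) := by
  rw [ContinuousLinearMap.isSelfAdjoint_iff_isSymmetric]
  intro f g
  change inner ℂ (idPlus b K hK f) g = inner ℂ f (idPlus b K hK g)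
  rw [← inner_conj_symm, inner_idPlus, inner_idPlus, map_add, inner_conj_symm, map_sum]
  congr 1
  simp only [map_sum]
  rw [Finset.sum_comm]
  refine Finset.sum_congr rfl fun i _ => Finset.sum_congr rfl fun j _ => ?_
  have hi : Integrable (fun q : ℝ × ℝ => starRingEnd ℂ (K q.2 q.1 j i *
      (star (g q.2 j) * f q.1 i))) ((vol b).prod (vol b)) :=
    (memLp_one_iff_integrable.2 (integrable_kernel_form hK g f j i).swap).star.integrable le_rfl
  rw [← integral_conj, ← integral_prod_swap]
  simp only [Prod.fst_swap, Prod.snd_swap]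
  rw [integral_prod _ hi, integral_prod _ (integrable_kernel_form hK f g i j)]
  refine integral_congr_ae (Filter.Eventually.of_forall fun x => integral_congr_ae ?_)
  filter_upwards [h x] with t ht
  rw [← ht, Matrix.conjTranspose_apply, map_mul, map_mul]
  simp only [starRingEnd_apply, star_star]
  ring

theorem k_neg (β : Matrix (Fin n) (Fin n) ℂ) (Θ₁ Θ₂ : Matrix (Fin n) (Fin p) ℂ) {x : ℝ}
    (hx : x ≠ 0) : (k β Θ₁ Θ₂ (-x))ᴴ = k β Θ₁ Θ₂ x := by
  rcases hx.lt_or_gt with h | h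
  · rw [k, k, if_pos (neg_pos.2 h), if_neg h.not_gt]
  · rw [k, k, if_neg (by linarith), if_pos h, Matrix.conjTranspose_conjTranspose, neg_neg]

theorem isSelfAdjoint_S (l : ℝ) {d : Fin p → ℝ} (hd : ∀ i, 0 < d i)
    (β : Matrix (Fin n) (Fin n) ℂ) (Θ₁ Θ₂ : Matrix (Fin n) (Fin p) ℂ) :
    IsSelfAdjoint (S l d β Θ₁ Θ₂) := by
  refine isSelfAdjoint_idPlus _ fun x => ?_
  -- The value `k(0)` need not be Hermitian, so the lines `d_i x = d_j t` are left out.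
  have h : ∀ i j, ∀ᵐ t ∂(vol l), t ≠ d i * x / d j := fun i j =>
    compl_mem_ae_iff.2 (measure_singleton _)
  filter_upwards [ae_all_iff.2 fun i => ae_all_iff.2 (h i)] with t ht
  ext i j
  have hne : d i * x - d j * t ≠ 0 := fun e =>
    ht i j (by rw [eq_div_iff (hd j).ne']; linarith)
  rw [Matrix.conjTranspose_apply, kernelS, kernelS, Matrix.of_apply, Matrix.of_apply,
    ← k_neg β Θ₁ Θ₂ hne, neg_sub, Matrix.conjTranspose_apply]

/-! ### The intertwining relation `S̃ E = E S` -/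

theorem integral_comp_div {l c : ℝ} (hc : 0 < c) {g : ℝ → ℂ} (hg : Measurable g) :
    ∫ z in Set.Ioo 0 (c * l), g (z / c) = c * ∫ t in Set.Ioo 0 l, g t := by
  have h := integral_map (μ := vol (c * l)) (φ := fun z : ℝ => z / c) (by fun_prop)
    hg.aestronglyMeasurable
  rw [map_div_vol hc, integral_smul_measure, ENNReal.toReal_ofReal hc.le] at h
  rw [← h, Complex.real_smul]

theorem coeFn_E [NeZero p] {l : ℝ} {d : Fin p → ℝ} (hd : ∀ i, 0 < d i) (f : L2 p l) :
    E l d hd f =ᵐ[vol (d 0 * l)] dilationFun l d f :=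
  (memLp_dilationFun hd f (d 0 * l)).coeFn_toLp

theorem integralFun_kernelSt_E [NeZero p] {l : ℝ} (hl : 0 < l) {d : Fin p → ℝ}
    (hd : ∀ i, 0 < d i) (hanti : Antitone d) (β : Matrix (Fin n) (Fin n) ℂ)
    (Θ₁ Θ₂ : Matrix (Fin n) (Fin p) ℂ) (f : L2 p l) (y : ℝ) (i : Fin p) :
    integralFun (d 0 * l) (kernelSt l d β Θ₁ Θ₂) (E l d hd f) y i =
      if y < d i * l then integralFun l (kernelS d β Θ₁ Θ₂) f (y / d i) i else 0 := by
  simp only [integralFun]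
  split_ifs with hy
  · refine Finset.sum_congr rfl fun j _ => ?_
    have hsub : Set.Ioo 0 (d j * l) ⊆ Set.Ioo 0 (d 0 * l) := Set.Ioo_subset_Ioo_right
      (mul_le_mul_of_nonneg_right (hanti (Fin.zero_le j)) hl.le)
    have hg : Measurable fun t => (1 / d j : ℂ) * (k β Θ₁ Θ₂ (y - d j * t) i j * f t j) :=
      measurable_const.mul (((measurable_k β Θ₁ Θ₂ i j).comp (by fun_prop)).mul
        (measurable_coord f j))
    have e1 : ∫ z in Set.Ioo 0 (d 0 * l), kernelSt l d β Θ₁ Θ₂ y z i j * E l d hd f z j =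
        ∫ z in Set.Ioo 0 (d 0 * l), (Set.Ioo 0 (d j * l)).indicator
          (fun z => (fun t => (1 / d j : ℂ) * (k β Θ₁ Θ₂ (y - d j * t) i j * f t j)) (z / d j))
          z := by
      refine integral_congr_ae ?_
      filter_upwards [coeFn_E hd f, ae_restrict_mem measurableSet_Ioo] with z hz hz'
      rw [hz]
      by_cases h : z < d j * l
      · rw [Set.indicator_of_mem (show z ∈ Set.Ioo 0 (d j * l) from ⟨hz'.1, h⟩)]
        simp only [kernelSt, Matrix.of_apply, dilationFun, h, hy, and_self, if_true]
        rw [mul_div_cancel₀ z (hd j).ne', mul_assoc]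
      · rw [Set.indicator_of_notMem (fun h' => h h'.2)]
        simp only [dilationFun, h, if_false, mul_zero]
    rw [e1, setIntegral_indicator measurableSet_Ioo, Set.inter_eq_right.2 hsub,
      integral_comp_div (hd j) hg, integral_const_mul, ← mul_assoc,
      mul_one_div_cancel (Complex.ofReal_ne_zero.2 (hd j).ne'), one_mul]
    simp only [kernelS, Matrix.of_apply, mul_div_cancel₀ y (hd i).ne']
  · refine Finset.sum_eq_zero fun j _ => ?_
    simp [kernelSt, hy]

theorem St_E [NeZero p] {l : ℝ} (hl : 0 < l) {d : Fin p → ℝ} (hd : ∀ i, 0 < d i)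
    (hanti : Antitone d) (β : Matrix (Fin n) (Fin n) ℂ) (Θ₁ Θ₂ : Matrix (Fin n) (Fin p) ℂ)
    (f : L2 p l) : St l d β Θ₁ Θ₂ (E l d hd f) = E l d hd (S l d β Θ₁ Θ₂ f) := by
  refine Lp.ext ?_
  have hS : ∀ᵐ x ∂(vol l), ∀ j,
      S l d β Θ₁ Θ₂ f x j = f x j + integralFun l (kernelS d β Θ₁ Θ₂) f x j := by
    filter_upwards [coeFn_idPlus (isBoundedKernel_kernelS l d β Θ₁ Θ₂) f] with x hx j
    rw [S, hx, PiLp.add_apply]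
  filter_upwards [coeFn_idPlus (isBoundedKernel_kernelSt l d β Θ₁ Θ₂ (d 0 * l)) (E l d hd f),
    coeFn_E hd f, coeFn_E hd (S l d β Θ₁ Θ₂ f), dilationFun_congr hd (d 0 * l) hS]
    with y h1 h2 h3 h4
  rw [St, h1, h2, h3]
  ext i
  rw [PiLp.add_apply, integralFun_kernelSt_E hl hd hanti]
  simp only [dilationFun]
  split_ifs with hy
  · exact (h4 i hy).symm
  · exact add_zero 0

/-- The coordinates of `f` are dilations of those of `E f`, so that `E` is bounded below. -/
theorem exists_norm_le_norm_E [NeZero p] {l : ℝ} (hl : 0 < l) {d : Fin p → ℝ}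
    (hd : ∀ i, 0 < d i) (hanti : Antitone d) :
    ∃ c : ℝ, 0 ≤ c ∧ ∀ f : L2 p l, ‖f‖ ≤ c * ‖E l d hd f‖ := by
  refine ⟨∑ j, (ENNReal.ofReal (d j) ^ (1 / 2 : ℝ)).toReal⁻¹, by positivity, fun f => ?_⟩
  have hcoord : ∀ j, (eLpNorm (fun x => f x j) 2 (vol l)).toReal ≤
      (ENNReal.ofReal (d j) ^ (1 / 2 : ℝ)).toReal⁻¹ * ‖E l d hd f‖ := by
    intro j
    have hpos : 0 < (ENNReal.ofReal (d j) ^ (1 / 2 : ℝ)).toReal :=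
      ENNReal.toReal_pos (by simpa using hd j)
        (ENNReal.rpow_ne_top_of_nonneg (by norm_num) ENNReal.ofReal_ne_top)
    rw [inv_mul_eq_div, le_div_iff₀' hpos, ← ENNReal.toReal_mul, Lp.norm_def]
    refine ENNReal.toReal_mono (Lp.memLp (E l d hd f)).2.ne ?_
    have hm : AEMeasurable (fun z : ℝ => z / d j) (vol (d j * l)) := by fun_prop
    have hn := eLpNorm_map_measure (p := 2) (f := fun z : ℝ => z / d j) (μ := vol (d j * l))
      (measurable_coord f j).aestronglyMeasurable hm
    rw [map_div_vol (hd j), eLpNorm_smul_measure_of_ne_top (by norm_num)] at hn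
    have hle : vol (d j * l) ≤ vol (d 0 * l) := Measure.restrict_mono
      (Set.Ioo_subset_Ioo_right (mul_le_mul_of_nonneg_right (hanti (Fin.zero_le j)) hl.le)) le_rfl
    calc ENNReal.ofReal (d j) ^ (1 / 2 : ℝ) * eLpNorm (fun x => f x j) 2 (vol l)
        = eLpNorm (fun z => f (z / d j) j) 2 (vol (d j * l)) := by
          rw [show (fun z => f (z / d j) j) = (fun x => f x j) ∘ fun z : ℝ => z / d j from rfl,
            ← hn]
          simp
      _ = eLpNorm (fun z => E l d hd f z j) 2 (vol (d j * l)) := by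
          refine eLpNorm_congr_ae ?_
          filter_upwards [ae_mono hle (coeFn_E hd f), ae_restrict_mem measurableSet_Ioo]
            with z hz hz'
          rw [hz]
          simp [dilationFun, hz'.2]
      _ ≤ eLpNorm (fun z => E l d hd f z j) 2 (vol (d 0 * l)) := eLpNorm_mono_measure _ hle
      _ ≤ eLpNorm (E l d hd f) 2 (vol (d 0 * l)) :=
          eLpNorm_mono fun z => PiLp.norm_apply_le (E l d hd f z) j
  have h1 : eLpNorm f 2 (vol l) ≤ ∑ j, eLpNorm (fun x => f x j) 2 (vol l) := by
    have h2 : eLpNorm f 2 (vol l) ≤ eLpNorm (∑ j, fun x => ‖f x j‖) 2 (vol l) := by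
      refine eLpNorm_mono_real fun x => ?_
      rw [Finset.sum_apply]
      exact norm_euclidean_le_sum _
    refine h2.trans ((eLpNorm_sum_le (fun j _ => (memLp_coord f j).1.norm) (by norm_num)).trans ?_)
    exact Finset.sum_le_sum fun j _ => (eLpNorm_norm _).le
  have hfin : ∀ j ∈ Finset.univ, eLpNorm (fun x => f x j) 2 (vol l) ≠ ⊤ := fun j _ =>
    (memLp_coord f j).2.ne
  rw [Lp.norm_def, Finset.sum_mul]
  refine (ENNReal.toReal_mono (ENNReal.sum_ne_top.2 hfin) h1).trans ?_
  rw [ENNReal.toReal_sum hfin]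
  exact Finset.sum_le_sum fun j _ => hcoord j

/-- A self-adjoint operator which is bounded below is invertible. -/
theorem isUnit_of_isSelfAdjoint_of_norm_le {H : Type*} [NormedAddCommGroup H]
    [InnerProductSpace ℂ H] [CompleteSpace H] {T : H →L[ℂ] H} (hT : IsSelfAdjoint T) {c : ℝ}
    (hc : 0 ≤ c) (h : ∀ f, ‖f‖ ≤ c * ‖T f‖) : IsUnit T := by
  rw [ContinuousLinearMap.isUnit_iff_bijective,
    ContinuousLinearMap.bijective_iff_dense_range_and_antilipschitz]
  refine ⟨?_, ⟨c, hc⟩, AddMonoidHomClass.antilipschitz_of_bound T h⟩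
  rw [Submodule.topologicalClosure_eq_top_iff, ContinuousLinearMap.orthogonal_range,
    hT.adjoint_eq, Submodule.eq_bot_iff]
  intro f hf
  have := h f
  rw [show T f = 0 from hf, norm_zero, mul_zero] at this
  exact norm_le_zero_iff.1 this

end DDiff

theorem mainTheorem1 {p n : ℕ} [NeZero p] (l : ℝ) (hl : 0 < l)
    (d : Fin p → ℝ) (hd : ∀ i, 0 < d i) (hanti : Antitone d)
    (β : Matrix (Fin n) (Fin n) ℂ) (Θ₁ Θ₂ : Matrix (Fin n) (Fin p) ℂ)
    (hdet : (DDiff.U l d β Θ₁ Θ₂ (d 0 * l)).toBlocks₂₂.det ≠ 0) :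
    IsSelfAdjoint (DDiff.S l d β Θ₁ Θ₂) ∧
    IsUnit (DDiff.S l d β Θ₁ Θ₂) ∧
    IsUnit (DDiff.St l d β Θ₁ Θ₂) ∧
    (∃ hT : DDiff.IsBoundedKernel (d 0 * l) (DDiff.kernelT l d β Θ₁ Θ₂),
      Ring.inverse (DDiff.St l d β Θ₁ Θ₂) =
        DDiff.idPlus (d 0 * l) (DDiff.kernelT l d β Θ₁ Θ₂) hT ∧
      ∃ hran : ∀ f : DDiff.L2 p l,
          DDiff.idPlus (d 0 * l) (DDiff.kernelT l d β Θ₁ Θ₂) hT (DDiff.E l d hd f) ∈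
            (DDiff.E l d hd).toLinearMap.range,
        ∀ f : DDiff.L2 p l,
          Ring.inverse (DDiff.S l d β Θ₁ Θ₂) f =
            DDiff.Einv hl hd hanti
              ⟨DDiff.idPlus (d 0 * l) (DDiff.kernelT l d β Θ₁ Θ₂) hT (DDiff.E l d hd f),
                hran f⟩) ∧
    ∀ y ∈ Set.Icc 0 (d 0 * l),
      (DDiff.U l d β Θ₁ Θ₂ y)ᴴ * DDiff.Jt n * DDiff.U l d β Θ₁ Θ₂ y = DDiff.Jt n := by
  have hT := DDiff.isBoundedKernel_kernelT l d β Θ₁ Θ₂ (d 0 * l)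
  set T := DDiff.idPlus (d 0 * l) (DDiff.kernelT l d β Θ₁ Θ₂) hT
  have hST : DDiff.St l d β Θ₁ Θ₂ * T = 1 :=
    DDiff.idPlus_kernelSt_mul_idPlus_kernelT hl hd hanti β Θ₁ Θ₂ hdet
  have hTS : T * DDiff.St l d β Θ₁ Θ₂ = 1 :=
    DDiff.idPlus_kernelT_mul_idPlus_kernelSt hl hd hanti β Θ₁ Θ₂ hdet
  have hsa := DDiff.isSelfAdjoint_S l hd β Θ₁ Θ₂
  have hE : ∀ f, T (DDiff.E l d hd (DDiff.S l d β Θ₁ Θ₂ f)) = DDiff.E l d hd f := by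
    intro f
    rw [← DDiff.St_E hl hd hanti]
    exact congrArg (fun X : DDiff.L2 p (d 0 * l) →L[ℂ] DDiff.L2 p (d 0 * l) =>
      X (DDiff.E l d hd f)) hTS
  -- `T̃ E S = E` bounds `S` below, because `E` is bounded below.
  have hS : IsUnit (DDiff.S l d β Θ₁ Θ₂) := by
    obtain ⟨c, hc0, hc⟩ := DDiff.exists_norm_le_norm_E hl hd hanti
    refine DDiff.isUnit_of_isSelfAdjoint_of_norm_le hsa
      (c := c * (‖T‖ * ‖DDiff.E l d hd‖)) (by positivity) fun f => ?_
    refine (hc f).trans ?_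
    rw [mul_assoc, ← hE f, mul_assoc]
    gcongr
    refine (T.le_opNorm _).trans ?_
    gcongr
    exact (DDiff.E l d hd).le_opNorm _
  -- Apply `T̃ E S = E` to `S⁻¹ f`.
  have hinv : ∀ f, T (DDiff.E l d hd f) =
      DDiff.E l d hd (Ring.inverse (DDiff.S l d β Θ₁ Θ₂) f) := by
    intro f
    have h : DDiff.S l d β Θ₁ Θ₂ (Ring.inverse (DDiff.S l d β Θ₁ Θ₂) f) = f :=
      congrArg (fun X : DDiff.L2 p l →L[ℂ] DDiff.L2 p l => X f) (Ring.mul_inverse_cancel _ hS)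
    rw [← hE (Ring.inverse (DDiff.S l d β Θ₁ Θ₂) f), h]
  have hran : ∀ f : DDiff.L2 p l, T (DDiff.E l d hd f) ∈ (DDiff.E l d hd).toLinearMap.range :=
    fun f => ⟨_, (hinv f).symm⟩
  refine ⟨hsa, hS, ⟨⟨_, T, hST, hTS⟩, rfl⟩, ⟨hT, ?_, hran, fun f => ?_⟩, fun y _ =>
    DDiff.U_Jt l d β Θ₁ Θ₂ y⟩
  · exact Ring.inverse_unit ⟨DDiff.St l d β Θ₁ Θ₂, T, hST, hTS⟩
  · rw [DDiff.Einv, LinearEquiv.eq_symm_apply]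
    exact Subtype.ext (hinv f).symm
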